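/- Let $s,n\ge 1$ be integers. For a commutative ring $R$, consider series $f=\sum_{|w|\ge 1}X_w(f)\,z_w$ without constant term in non-commuting variables $z_1,\dots,z_s$, where $w$ runs over the non-empty words in the alphabet $\{1,\dots,s\}$. For a word $w=(i_1\dots i_m)$ and a partition $\pi$ of $\{1,\dots,m\}$ put $X_{w,\pi}(f)=\prod_{V}X_{w|_V}(f)$, the product over the blocks $V=\{v_1<\dots<v_r\}$ of $\pi$, with $w|_V=(i_{v_1}\dots i_{v_r})$. The boxed convolution is $$X_w(f\boxtimes g)=\sum_{\pi\in \mathrm{NC}(m)}X_{w,\pi}(f)\,X_{w,K(\pi)}(g),$$ where $\mathrm{NC}(m)$ is the set of non-crossing partitions of $\{1,\dots,m\}$ and $K(\pi)$ is the Kreweras complement of $\pi$, i.e. the coarsest partition of $\{1',\dots,m'\}$ whose union with $\pi$ is non-crossing for the order $1<1'<2<2'<\dots<m<m'$. Let $$(\mathfrak G^s)_n(R)=\Big\{\sum_{1\le|w|\le n}\alpha_wz_w : \alpha_1,\dots,\alpha_s\in R^\times\Big\},\qquad (\mathfrak G^s_+)_n(R)=\Big\{\sum_{1\le|w|\le n}\alpha_wz_w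 : \alpha_1=\dots=\alpha_s=1\Big\},$$ with the operation $\boxtimes$, computed modulo terms of degree $>n$. Let $\mathbb B_N(R)\subseteq \mathrm{GL}_N(R)$ be the group of invertible upper triangular matrices, $\mathbb U_N(R)$ the group of upper triangular matrices with diagonal entries $1$, and $\mathbb T_N(R)$ the group of matrices $\operatorname{diag}(t_1,\dots,t_N)$ with $t_i\in R^\times$. For functors $G$ and $H$ from commutative $k$-algebras to groups, with $H(R)\subseteq\mathrm{GL}_N(R)$, a faithful representation of $G$ over $k$ as a closed subgroup of $H$ is a family of injective homomorphisms $\rho_R:G(R)\to H(R)$, natural in the commutative $k$-algebra $R$, for which there is a set $E$ of polynomials over $k$ in $N^2$ variables such that for every $R$ the image of $\rho_R$ is the set of those $M\in H(R)$ whose entries satisfy all equations in $E$. In particular, for $R=k$, $\rho_k$ is an isomorphism of $G(k)$ onto a Zariski closed subgroup of $H(k)$. **Theorem.** Let $s,n\ge1$. There is an integer $N=N(n,s)$ such that for every field $k$: 1. $(\mathfrak G^s)_n(R)$ and $(\mathfrak G^s_+)_n(R)$ are groups under $\boxtimes$ for every commutative $k$-algebra $R$; 2. $(\mathfrak G^s)_n$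 has a faithful representation over $k$ as a closed subgroup of the Borel group $\mathbb B_N$; 3. $(\mathfrak G^s_+)_n$ has a faithful representation over $k$ as a closed subgroup of the unipotent group $\mathbb U_N$. Moreover, for every $s\ge 1$ and every field $k$, $(\mathfrak G^s)_1$ has a faithful representation over $k$ in $\mathrm{GL}_s$ whose image is, for every commutative $k$-algebra $R$, the whole torus $\mathbb T_s(R)$. -/

import Mathlib

open Finset

universe u

/-! ### Non-crossing partitions and the Kreweras complement -/

/-- A relation on an ordered type is non-crossing if there are no `a < b < c < d` with `a`, `c`
in one class and `b`, `d` in another one. -/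
def NonCrossingRel {α : Type*} [LT α] (r : α → α → Prop) : Prop :=
  ∀ a b c d : α, a < b → b < c → c < d → r a c → r b d → r a b

/-- Two points lie in the same block of a partition of `{0, …, m - 1}`. -/
def SameBlock {m : ℕ} (π : Finpartition (univ : Finset (Fin m))) (a b : Fin m) : Prop :=
  π.part a = π.part b

/-- `NC(m)`: the set of non-crossing partitions of an `m`-element chain. -/
noncomputable def NC (m : ℕ) : Finset (Finpartition (univ : Finset (Fin m))) :=
  open Classical in univ.filter fun π => NonCrossingRel (SameBlock π)

/-- The relation "same block" of the union of `π`, put on the points `0, 1, …`, and `σ`, put on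
the points `0', 1', …`, where all points are ordered by `0 < 0' < 1 < 1' < ⋯`.
Here `(a, false)` is the point `a`, and `(a, true)` is the point `a'`. -/
def InterleavedBlock {m : ℕ} (π σ : Finpartition (univ : Finset (Fin m)))
    (x y : Fin m ×ₗ Bool) : Prop :=
  (ofLex x).2 = (ofLex y).2 ∧
    if (ofLex x).2 then SameBlock σ (ofLex x).1 (ofLex y).1
    else SameBlock π (ofLex x).1 (ofLex y).1

/-- `i'` and `j'` (say `i ≤ j`) are equivalent if the interval `{i + 1, …, j}` of points between
them is a union of blocks of `π`. -/
def krewerasSetoid {m : ℕ} (π : Finpartition (univ : Finset (Fin m))) : Setoid (Fin m) where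
  r i j := ∀ a b, SameBlock π a b → ((a ≤ i ↔ a ≤ j) ↔ (b ≤ i ↔ b ≤ j))
  iseqv :=
    { refl := fun _ _ _ _ => by tauto
      symm := fun h a b hab => by have := h a b hab; tauto
      trans := fun h h' a b hab => by have := h a b hab; have := h' a b hab; tauto }

/-- The Kreweras complement `K(π)`. -/
noncomputable def kreweras {m : ℕ} (π : Finpartition (univ : Finset (Fin m))) :
    Finpartition (univ : Finset (Fin m)) :=
  open Classical in Finpartition.ofSetoid (krewerasSetoid π)

theorem sameBlock_kreweras {m : ℕ} (π : Finpartition (univ : Finset (Fin m))) (i j : Fin m) :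
    SameBlock (kreweras π) i j ↔
      ∀ a b, SameBlock π a b → ((a ≤ i ↔ a ≤ j) ↔ (b ≤ i ↔ b ≤ j)) := by
  classical
  have h : i ∈ (kreweras π).part j ↔ (krewerasSetoid π) j i := by
    unfold kreweras
    exact Finpartition.mem_part_ofSetoid_iff_rel
  rw [SameBlock, ← Finpartition.mem_part_iff_part_eq_part _ (mem_univ i) (mem_univ j), h]
  exact ⟨fun h => (krewerasSetoid π).symm' h, fun h => (krewerasSetoid π).symm' h⟩

/-- The explicit description above is the usual one: `K(π)` is the coarsest partition `σ` of
`0', 1', …` such that the union of `π` and `σ` is non-crossing for `0 < 0' < 1 < 1' < ⋯`. -/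
theorem kreweras_isGreatest {m : ℕ} {π : Finpartition (univ : Finset (Fin m))}
    (hπ : NonCrossingRel (SameBlock π)) :
    IsGreatest {σ | NonCrossingRel (InterleavedBlock π σ)} (kreweras π) := by
  have hlt : ∀ (a b : Fin m) (x y : Bool), toLex (a, x) < toLex (b, y) ↔
      a < b ∨ a = b ∧ x < y := fun a b x y => Prod.Lex.toLex_lt_toLex
  constructor
  · rintro ⟨a, x⟩ ⟨b, y⟩ ⟨c, z⟩ ⟨d, t⟩ hab hbc hcd ⟨hxz, hac⟩ ⟨hyt, hbd⟩
    have hab := (hlt a b x y).1 hab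
    have hbc := (hlt b c y z).1 hbc
    have hcd := (hlt c d z t).1 hcd
    change x = z at hxz
    change y = t at hyt
    change (if x then SameBlock (kreweras π) a c else SameBlock π a c) at hac
    change (if y then SameBlock (kreweras π) b d else SameBlock π b d) at hbd
    change x = y ∧ (if x then SameBlock (kreweras π) a b else SameBlock π a b)
    subst hxz hyt
    cases x <;> cases y <;> simp [sameBlock_kreweras, Bool.lt_iff] at hab hbc hcd hac hbd ⊢
    · exact hπ a b c d hab hbc hcd hac hbd
    · have := hbd a c hac
      omega
    · have := hac b d hbd
      omega
    · intro p q hpq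
      have h1 := hac p q hpq
      have h2 := hbd p q hpq
      omega
  · intro σ hσ V hV
    obtain ⟨i, hi⟩ := σ.nonempty_of_mem_parts hV
    refine ⟨(kreweras π).part i, (kreweras π).part_mem.2 (mem_univ i), fun j hj => ?_⟩
    have hij : SameBlock σ i j := by
      rw [SameBlock, σ.part_eq_of_mem hV hi, σ.part_eq_of_mem hV hj]
    rw [Finpartition.mem_part_iff_part_eq_part _ (mem_univ j) (mem_univ i)]
    suffices h : ∀ i j : Fin m, SameBlock σ i j → i ≤ j → ∀ a b, SameBlock π a b →
        i < a → a ≤ j → i < b ∧ b ≤ j by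
      refine ((sameBlock_kreweras π i j).2 fun a b hab => ?_).symm
      rcases le_total i j with hle | hle
      · have h1 := h i j hij hle a b hab
        have h2 := h i j hij hle b a hab.symm
        omega
      · have h1 := h j i hij.symm hle a b hab
        have h2 := h j i hij.symm hle b a hab.symm
        omega
    intro i j hij hle a b hab hia haj
    have hft : ∀ c d : Fin m, c ≤ d → toLex (c, false) < toLex (d, true) :=
      fun c d h => (hlt _ _ _ _).2 (h.lt_or_eq.imp_right fun h => ⟨h, by decide⟩)
    have htf : ∀ c d : Fin m, c < d → toLex (c, true) < toLex (d, false) :=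
      fun c d h => (hlt _ _ _ _).2 (Or.inl h)
    have hl : ∀ (c d : Fin m), SameBlock π c d →
        InterleavedBlock π σ (toLex (c, false)) (toLex (d, false)) :=
      fun c d h => ⟨rfl, by simpa using h⟩
    have hr : InterleavedBlock π σ (toLex (i, true)) (toLex (j, true)) :=
      ⟨rfl, by simpa using hij⟩
    by_contra hb
    by_cases hbi : b ≤ i
    · have := hσ (toLex (b, false)) (toLex (i, true)) (toLex (a, false)) (toLex (j, true))
        (hft b i hbi) (htf i a hia) (hft a j haj) (hl b a hab.symm) hr
      simpa using this.1
    · have := hσ (toLex (i, true)) (toLex (a, false)) (toLex (j, true)) (toLex (b, false))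
        (htf i a hia) (hft a j haj) (htf j b (by omega)) hr (hl a b hab)
      simpa using this.1

/-! ### Series in non-commuting variables and the boxed convolution -/

/-- A series `∑ α_w z_w` in the non-commuting variables `z_1, …, z_s` over `R`, given by its
coefficients; words in the alphabet `{1, …, s}` are lists. -/
abbrev NCSeries (s : ℕ) (R : Type*) := List (Fin s) → R

/-- `X_{w,π}(f)`: the product over the blocks `V = {v_1 < ⋯ < v_r}` of `π` of the coefficient of
`f` at the word `w_{v_1} ⋯ w_{v_r}`. -/
def blockCoeff {s : ℕ} {R : Type*} [CommRing R] (w : List (Fin s))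
    (π : Finpartition (univ : Finset (Fin w.length))) (f : NCSeries s R) : R :=
  ∏ V ∈ π.parts, f (V.sort.map w.get)

/-- The boxed convolution `f ⊠ g` of series without constant term. -/
noncomputable def boxConv {s : ℕ} {R : Type*} [CommRing R] (f g : NCSeries s R) : NCSeries s R :=
  fun w => if w = [] then 0 else ∑ π ∈ NC w.length, blockCoeff w π f * blockCoeff w (kreweras π) g

/-- The series is a combination of the `z_w` with `1 ≤ |w| ≤ n`. -/
def IsTruncated {s : ℕ} {R : Type*} [CommRing R] (n : ℕ) (f : NCSeries s R) : Prop :=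
  ∀ w, ¬(1 ≤ w.length ∧ w.length ≤ n) → f w = 0

/-- The terms `α_w z_w` with `1 ≤ |w| ≤ n` of a series. -/
def truncate {s : ℕ} {R : Type*} [CommRing R] (n : ℕ) (f : NCSeries s R) : NCSeries s R :=
  fun w => if 1 ≤ w.length ∧ w.length ≤ n then f w else 0

theorem isTruncated_truncate {s : ℕ} {R : Type*} [CommRing R] (n : ℕ) (f : NCSeries s R) :
    IsTruncated n (truncate n f) :=
  fun _ hw => if_neg hw

theorem boxConv_singleton {s : ℕ} {R : Type*} [CommRing R] (f g : NCSeries s R) (i : Fin s) :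
    boxConv f g [i] = f [i] * g [i] := by
  have hsub : ∀ π σ : Finpartition (univ : Finset (Fin 1)), π = σ := fun π σ => by
    have h : ∀ τ : Finpartition (univ : Finset (Fin 1)), τ.parts = {univ} := fun τ => by
      refine Finset.eq_singleton_iff_nonempty_unique_mem.2
        ⟨τ.parts_nonempty (Finset.univ_nonempty.ne_empty), fun V hV => ?_⟩
      obtain ⟨x, hx⟩ := τ.nonempty_of_mem_parts hV
      exact Finset.eq_univ_of_forall fun y => Subsingleton.elim x y ▸ hx
    exact Finpartition.ext ((h π).trans (h σ).symm)
  have hb : ∀ (π : Finpartition (univ : Finset (Fin ([i] : List (Fin s)).length)))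
      (h : NCSeries s R), blockCoeff [i] π h = h [i] := fun π h => by
    rw [hsub π (Finpartition.indiscrete (Finset.univ_nonempty (α := Fin 1)).ne_empty)]
    simp [blockCoeff]
  have hNC : NC ([i] : List (Fin s)).length =
      {Finpartition.indiscrete (Finset.univ_nonempty (α := Fin 1)).ne_empty} := by
    refine Finset.eq_singleton_iff_unique_mem.2 ⟨?_, fun π _ => hsub _ _⟩
    simp only [NC, mem_filter, mem_univ, true_and]
    intro a b c d hab
    exact absurd hab (by simp [Subsingleton.elim (α := Fin 1) a b])
  simp only [boxConv, hNC, hb]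
  simp

/-- `(𝔊^s)_n(R)`. -/
def GTrunc (s n : ℕ) (R : Type u) [CommRing R] : Type u :=
  {f : NCSeries s R // IsTruncated n f ∧ ∀ i, IsUnit (f [i])}

/-- `(𝔊^s_+)_n(R)`. -/
def GPlusTrunc (s n : ℕ) (R : Type u) [CommRing R] : Type u :=
  {f : NCSeries s R // IsTruncated n f ∧ ∀ i, f [i] = 1}

/-- The operation `⊠` on `(𝔊^s)_n(R)`, up to degree `n`. -/
noncomputable instance (s n : ℕ) (R : Type u) [CommRing R] : Mul (GTrunc s n R) where
  mul f g := ⟨truncate n (boxConv f.1 g.1), isTruncated_truncate n _, fun i => by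
    by_cases hn : 1 ≤ n
    · simpa [truncate, hn, boxConv_singleton] using And.intro (f.2.2 i) (g.2.2 i)
    · have h : f.1 [i] = 0 := f.2.1 [i] (by simp; omega)
      have h' := f.2.2 i
      rw [h, isUnit_zero_iff] at h'
      have := subsingleton_of_zero_eq_one h'
      exact isUnit_of_subsingleton _⟩

/-- The operation `⊠` on `(𝔊^s_+)_n(R)`, up to degree `n`. -/
noncomputable instance (s n : ℕ) (R : Type u) [CommRing R] : Mul (GPlusTrunc s n R) where
  mul f g := ⟨truncate n (boxConv f.1 g.1), isTruncated_truncate n _, fun i => by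
    by_cases hn : 1 ≤ n
    · simp [truncate, hn, boxConv_singleton, f.2.2 i, g.2.2 i]
    · have h : f.1 [i] = 0 := f.2.1 [i] (by simp; omega)
      have := subsingleton_of_zero_eq_one (h.symm.trans (f.2.2 i))
      exact Subsingleton.elim _ _⟩

/-- Change of coefficients in `(𝔊^s)_n`. -/
def GTrunc.map {s n : ℕ} {R S : Type u} [CommRing R] [CommRing S] (φ : R →+* S)
    (f : GTrunc s n R) : GTrunc s n S :=
  ⟨fun w => φ (f.1 w), fun w hw => (congrArg φ (f.2.1 w hw)).trans (map_zero φ), fun i => (f.2.2 i).map φ⟩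

/-- Change of coefficients in `(𝔊^s_+)_n`. -/
def GPlusTrunc.map {s n : ℕ} {R S : Type u} [CommRing R] [CommRing S] (φ : R →+* S)
    (f : GPlusTrunc s n R) : GPlusTrunc s n S :=
  ⟨fun w => φ (f.1 w), fun w hw => (congrArg φ (f.2.1 w hw)).trans (map_zero φ),
    fun i => (congrArg φ (f.2.2 i)).trans (map_one φ)⟩

/-- The multiplication of `G` is a group operation. -/
def IsGroupOperation (G : Type*) [Mul G] : Prop :=
  ∃ inst : Group G, ∀ a b : G, inst.mul a b = a * b

/-! ### Groups of matrices -/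

/-- The torus `𝕋_N(R)`: the matrices `diag(t_1, …, t_N)` with units `t_i`. -/
def torusGroup (N : ℕ) (R : Type*) [CommRing R] : Subgroup (GL (Fin N) R) :=
  ((Units.map (Matrix.diagonalRingHom (Fin N) R).toMonoidHom).comp
    (MulEquiv.piUnits (M := fun _ : Fin N => R)).symm.toMonoidHom).range

/-- The Borel group `𝔹_N(R)` of invertible upper triangular matrices. -/
def borelGroup (N : ℕ) (R : Type*) [CommRing R] : Subgroup (GL (Fin N) R) where
  carrier := {M | ∀ i j, j < i → M.1 i j = 0}
  one_mem' := Matrix.blockTriangular_one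
  mul_mem' {A B} hA hB := Matrix.BlockTriangular.mul (M := A.1) (N := B.1) (b := id) hA hB
  inv_mem' {A} hA := by
    have h := Matrix.blockTriangular_inv_of_blockTriangular (M := A.1) (b := id) hA
    rw [← Matrix.coe_units_inv] at h
    exact h

theorem borelGroup_mul_diag {N : ℕ} {R : Type*} [CommRing R] {A B : GL (Fin N) R}
    (hA : A ∈ borelGroup N R) (hB : B ∈ borelGroup N R) (i : Fin N) :
    (A * B).1 i i = A.1 i i * B.1 i i := by
  rw [Units.val_mul, Matrix.mul_apply]
  refine Finset.sum_eq_single i (fun j _ hj => ?_) (fun h => absurd (mem_univ i) h)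
  rcases lt_or_gt_of_ne hj with h | h
  · rw [hA i j h, zero_mul]
  · rw [hB j i h, mul_zero]

/-- The unipotent group `𝕌_N(R)` of upper triangular matrices with diagonal entries `1`. -/
def unipotentGroup (N : ℕ) (R : Type*) [CommRing R] : Subgroup (GL (Fin N) R) where
  carrier := {M | M ∈ borelGroup N R ∧ ∀ i, M.1 i i = 1}
  one_mem' := ⟨one_mem _, fun i => by simp⟩
  mul_mem' {A B} hA hB := ⟨mul_mem hA.1 hB.1, fun i => by
    rw [borelGroup_mul_diag hA.1 hB.1, hA.2, hB.2, mul_one]⟩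
  inv_mem' {A} hA := ⟨inv_mem hA.1, fun i => by
    have h := borelGroup_mul_diag hA.1 (inv_mem hA.1) i
    rw [mul_inv_cancel, hA.2, one_mul] at h
    simpa using h.symm⟩

/-! ### Faithful representations as closed subgroups -/

/-- Let `G` be a functor from `k`-algebras to sets with multiplication, with action `map` on
morphisms, and let `H R` be subgroups of `GL_N(R)`. The maps `ρ R : G R → GL_N(R)` are a faithful
representation of `G` over `k` as a closed subgroup of `H`: they are multiplicative, natural
in `R` (so that `ρ` is a morphism of functors on `k`-algebras), injective, with values in `H R`,
and the image is the subset of `H R` that is cut out by polynomial equations with coefficients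
in `k` in the matrix entries, the same ones for all `R`. -/
structure IsFaithfulClosedRep (k : Type u) [Field k]
    (G : (R : Type u) → [CommRing R] → Type u) [(R : Type u) → [CommRing R] → Mul (G R)]
    (map : {R S : Type u} → [CommRing R] → [CommRing S] → (R →+* S) → G R → G S)
    {N : ℕ} (H : (R : Type u) → [CommRing R] → Subgroup (GL (Fin N) R))
    (ρ : (R : Type u) → [CommRing R] → [Algebra k R] → G R → GL (Fin N) R) : Prop where
  map_mul : ∀ (R : Type u) [CommRing R] [Algebra k R] (f g : G R), ρ R (f * g) = ρ R f * ρ R g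
  natural : ∀ (R S : Type u) [CommRing R] [CommRing S] [Algebra k R] [Algebra k S]
    (φ : R →ₐ[k] S) (f : G R),
    ρ S (map φ.toRingHom f) = Matrix.GeneralLinearGroup.map φ.toRingHom (ρ R f)
  injective : ∀ (R : Type u) [CommRing R] [Algebra k R], Function.Injective (ρ R)
  closed : ∃ E : Set (MvPolynomial (Fin N × Fin N) k),
    ∀ (R : Type u) [CommRing R] [Algebra k R],
      Set.range (ρ R) =
        {M | M ∈ H R ∧ ∀ p ∈ E, MvPolynomial.aeval (fun e => M.1 e.1 e.2) p = 0}

/-! Boxed convolution is convolution of multiplicative functions on non-crossing partitions.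
Expanding both bracketings of a triple product gives sums over chains `Q ≤ P` with factors on `(Q,
K_P(Q), K(P))`, and over pairs `σ ≤ K(Q)` with factors on `(Q, σ, K_{K(Q)}(σ))`, where `K_P` is the
complement taken inside each block of `P`. The identity `K_{K(Q)}(K_P(Q)) = K(P)`
(`krewerasRel_krewerasRel`) and the invertibility of the complement (`invKrewerasRel_krewerasRel`)
match these sums, which is associativity. The sum of the letters is a left unit. The coefficient of
`f` at `w` enters that of `f ⊠ g` at `w` linearly, multiplied by the letter coefficients of `g`
along `w`, so left inverses are found by recursion on the length of words.

For the representation, the group acts on polynomials in the coefficients of a generic series `Z` by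
substituting `f ⊠ Z` for `Z`. The block sizes of `K(π)` add up to the length of `w`, so giving each
variable the length of its word as weight makes the action weight-preserving
(`isWeightedHomogeneous_boxSubst`), and the polynomials of weight at most `n` form a free invariant
module of finite rank. Up to terms of higher degree, a monomial is only multiplied by a scalar
(`boxSubst_monomial_sub_mem`), so ordering the monomials by degree makes the matrices upper
triangular, with diagonal `1` when the letter coefficients are `1`. The coefficient of `f` at `w` is
itself a matrix entry (`coeff_letterExponent_boxSubst`). Hence the representation is faithful, and
its image consists of the matrices that agree with the matrix of the series read off from them: a
polynomial condition, uniform in the algebra. The rank depends only on `s` and `n`. For `n = 1` only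
the letter coefficients remain, and they multiply separately. -/

/-! ### The relative Kreweras complement of relations -/

section KrewerasRel

variable {α : Type*} [LinearOrder α]

/-- The Kreweras complement of `r` inside each class of `p`. -/
def KrewerasRel (p r : α → α → Prop) (i j : α) : Prop :=
  p i j ∧ ∀ a b, p i a → r a b → ((a ≤ i ↔ a ≤ j) ↔ (b ≤ i ↔ b ≤ j))

/-- The inverse Kreweras complement of `r` inside each class of `p`. -/
def InvKrewerasRel (p r : α → α → Prop) (i j : α) : Prop :=
  p i j ∧ ∀ a b, p i a → r a b → ((i ≤ a ↔ j ≤ a) ↔ (i ≤ b ↔ j ≤ b))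

/-- A symmetric and transitive relation. -/
structure IsPER {α : Type*} (r : α → α → Prop) : Prop where
  symm : ∀ {a b}, r a b → r b a
  trans : ∀ {a b c}, r a b → r b c → r a c

theorem IsPER.left {α : Type*} {r : α → α → Prop} (h : IsPER r) {a b : α} (hab : r a b) : r a a :=
  h.trans hab (h.symm hab)

theorem IsPER.right {α : Type*} {r : α → α → Prop} (h : IsPER r) {a b : α} (hab : r a b) : r b b :=
  h.trans (h.symm hab) hab

/-- `InvKrewerasRel` is definitionally `KrewerasRel` for the reversed order. Passing to `αᵒᵈ`
therefore turns each result on the complement into one on its inverse. -/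
theorem NonCrossingRel.dual {r : α → α → Prop} (hr : IsPER r) (h : NonCrossingRel r) :
    NonCrossingRel (α := αᵒᵈ) r := fun a b c d hab hbc hcd hac hbd => by
  have h1 := h d c b a hcd hbc hab (hr.symm hbd) (hr.symm hac)
  exact hr.trans hac (hr.trans (hr.symm h1) (hr.symm hbd))

theorem NonCrossingRel.of_dual {r : α → α → Prop} (hr : IsPER r)
    (h : NonCrossingRel (α := αᵒᵈ) r) : NonCrossingRel r :=
  NonCrossingRel.dual (α := αᵒᵈ) hr h

variable {p r : α → α → Prop}

theorem IsPER.krewerasRel (hp : IsPER p) : IsPER (KrewerasRel p r) where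
  symm h := ⟨hp.symm h.1, fun a b ha hab => by
    have := h.2 a b (hp.trans h.1 ha) hab
    tauto⟩
  trans h h' := ⟨hp.trans h.1 h'.1, fun a b ha hab => by
    have h1 := h.2 a b ha hab
    have h2 := h'.2 a b (hp.trans (hp.symm h.1) ha) hab
    tauto⟩

theorem IsPER.invKrewerasRel (hp : IsPER p) : IsPER (InvKrewerasRel p r) :=
  IsPER.krewerasRel (α := αᵒᵈ) hp

theorem krewerasRel_self {i : α} (hi : p i i) : KrewerasRel p r i i := ⟨hi, fun _ _ _ _ => by tauto⟩

/-- For `a < b < c < d` one has `(a, b] = (a, c] \ (b, d]`, and a difference of unions of classes is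
again a union of classes. -/
theorem NonCrossingRel.krewerasRel (hp : IsPER p) (hpn : NonCrossingRel p) :
    NonCrossingRel (KrewerasRel p r) := fun a b c d hab hbc hcd hac hbd => by
  have h1 : p a b := hpn a b c d hab hbc hcd hac.1 hbd.1
  refine ⟨h1, fun x y hx hxy => ?_⟩
  have h2 := hac.2 x y hx hxy
  have h3 := hbd.2 x y (hp.trans (hp.symm h1) hx) hxy
  grind

theorem NonCrossingRel.invKrewerasRel (hp : IsPER p) (hpn : NonCrossingRel p) :
    NonCrossingRel (InvKrewerasRel p r) :=
  NonCrossingRel.of_dual (IsPER.invKrewerasRel hp)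
    (NonCrossingRel.krewerasRel (α := αᵒᵈ) hp (hpn.dual hp))

/-- A class of `r` not inside the `p`-class of `i` and `j` lies in another `p`-class, which cannot
cross the pair `i`, `j`; so it is not cut by `(i, j]` either. -/
theorem krewerasRel_le_krewerasRel_top (hp : IsPER p) (hpn : NonCrossingRel p) (hr : IsPER r)
    (hrp : r ≤ p) : KrewerasRel p r ≤ KrewerasRel (fun _ _ => True) r := by
  have key : ∀ i j, i ≤ j → KrewerasRel p r i j → ∀ a b, r a b → i < a → a ≤ j → i < b ∧ b ≤ j := by
    intro i j hle hij a b hab hia haj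
    by_cases ha : p i a
    · have := hij.2 a b ha hab
      grind
    have hpab := hrp _ _ hab
    have hb : ¬ p i b := fun h => ha (hp.trans h (hp.symm hpab))
    have haj' : a < j := lt_of_le_of_ne haj fun h => ha (h ▸ hij.1)
    have hne : b ≠ i := fun h => hb (h.symm ▸ hp.left hij.1)
    by_contra hcon
    by_cases hbi : b < i
    · have := hpn b i a j hbi hia haj' (hp.symm hpab) hij.1
      exact hb (hp.symm this)
    · exact ha (hpn i a j b hia haj' (by grind) hij.1 hpab)
  intro i j hij
  refine ⟨trivial, fun a b _ hab => ?_⟩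
  rcases le_total i j with hle | hle
  · have h1 := key i j hle hij a b hab
    have h2 := key i j hle hij b a (hr.symm hab)
    grind
  · have h1 := key j i hle ((IsPER.krewerasRel hp).symm hij) a b hab
    have h2 := key j i hle ((IsPER.krewerasRel hp).symm hij) b a (hr.symm hab)
    grind

variable [Finite α]

theorem exists_greatest_of_finite {P : α → Prop} (h : ∃ x, P x) : ∃ x, P x ∧ ∀ y, P y → y ≤ x := by
  obtain ⟨x, hx, hmax⟩ := Set.exists_max_image {x | P x} id (Set.toFinite _) h
  exact ⟨x, hx, hmax⟩

theorem exists_least_of_finite {P : α → Prop} (h : ∃ x, P x) : ∃ x, P x ∧ ∀ y, P y → x ≤ y :=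
  exists_greatest_of_finite (α := αᵒᵈ) h

/-- If `j` lies strictly between points `i < j` not related by `r`, some class of the Kreweras
complement meets `[i, j)` and its complement. -/
theorem exists_krewerasRel_of_not_rel (hp : IsPER p) (hr : IsPER r) (hrn : NonCrossingRel r)
    (hrp : r ≤ p) {i j : α} (hlt : i < j) (hij : p i j) (hri : r i i) (hn : ¬ r i j) :
    ∃ a b, p i a ∧ KrewerasRel p r a b ∧ i ≤ a ∧ a < j ∧ ¬ (i ≤ b ∧ b < j) := by
  -- The first witness is the last point `x` before `j` in the `r`-class of `i`; the second is the
  -- last point of the `p`-class before the next point of that `r`-class, in cyclic order.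
  obtain ⟨x, ⟨hx, hxj⟩, hxmax⟩ := exists_greatest_of_finite (P := fun x => r i x ∧ x < j) ⟨i, hri, hlt⟩
  have hix : i ≤ x := hxmax i ⟨hri, hlt⟩
  by_cases hq : ∃ q, r i q ∧ j < q
  · obtain ⟨q, ⟨hq, hjq⟩, hqmin⟩ := exists_least_of_finite hq
    obtain ⟨b, ⟨hb, hbq⟩, hbmax⟩ :=
      exists_greatest_of_finite (P := fun b => p i b ∧ b < q) ⟨j, hij, hjq⟩
    have hjb := hbmax j ⟨hij, hjq⟩
    refine ⟨x, b, hrp _ _ hx, ⟨hp.trans (hp.symm (hrp _ _ hx)) hb, ?_⟩, hix, hxj, by grind⟩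
    -- Since `x` and `q` are consecutive in their `r`-class, any other class with a point between
    -- them is trapped there by non-crossing.
    have key : ∀ c d, p x c → r c d → x < c → c ≤ b → x < d ∧ d ≤ b := fun c d hc hcd hxc hcb => by
      have hpd : p i d := hp.trans (hp.trans (hrp _ _ hx) hc) (hrp _ _ hcd)
      have hnc : ¬ r i c := fun h => by
        rcases lt_trichotomy c j with h1 | rfl | h1
        · exact absurd (hxmax c ⟨h, h1⟩) (by grind)
        · exact hn h
        · exact absurd (hqmin c ⟨h, h1⟩) (by grind)
      have hnx : ¬ r x c := fun h => hnc (hr.trans hx h)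
      have hxq : r x q := hr.trans (hr.symm hx) hq
      have hnd : ∀ e, r i e → d ≠ e := by
        rintro e he rfl
        exact hnc (hr.trans he (hr.symm hcd))
      constructor
      · by_contra hd
        have hdx : d < x := lt_of_le_of_ne (not_lt.1 hd) (hnd x hx)
        have := hrn d x c q hdx hxc (by grind) (hr.symm hcd) hxq
        exact hnx (hr.trans (hr.symm this) (hr.symm hcd))
      · by_contra hd
        have hqd : q < d := by
          rcases lt_trichotomy d q with h | h | h
          · exact absurd (hbmax d ⟨hpd, h⟩) hd
          · exact absurd h (hnd q hq)
          · exact h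
        exact hnx (hrn x c q d hxc (by grind) hqd hxq hcd)
    intro c d hc hcd
    have h1 := key c d hc hcd
    have h2 := key d c (hp.trans hc (hrp _ _ hcd)) (hr.symm hcd)
    grind
  -- Now `x` is the last point of its `r`-class, so the next point cyclically is the first one, `y`.
  -- The interval `[y, x]` is a union of `r`-classes.
  · obtain ⟨y, hy, hymin⟩ := exists_least_of_finite (P := fun y => r i y) ⟨i, hri⟩
    have hyi := hymin i hri
    have hmax : ∀ c, r i c → c ≤ x := fun c hc => by
      rcases lt_trichotomy c j with h1 | rfl | h1
      · exact hxmax c ⟨hc, h1⟩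
      · exact absurd hc hn
      · exact absurd ⟨c, hc, h1⟩ hq
    have hxy : r y x := hr.trans (hr.symm hy) hx
    have key : ∀ c d, r c d → y ≤ c → c ≤ x → y ≤ d ∧ d ≤ x := fun c d hcd hyc hcx => by
      by_cases hic : r i c
      · exact ⟨hymin d (hr.trans hic hcd), hmax d (hr.trans hic hcd)⟩
      have hyc' : y < c := lt_of_le_of_ne hyc fun h => hic (h ▸ hy)
      have hcx' : c < x := lt_of_le_of_ne hcx fun h => hic (h ▸ hx)
      constructor
      · by_contra hd
        have := hrn d y c x (not_le.1 hd) hyc' hcx' (hr.symm hcd) hxy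
        exact hic (hr.trans hy (hr.trans (hr.symm this) (hr.symm hcd)))
      · by_contra hd
        exact hic (hr.trans hy (hrn y c x d hyc' hcx' (not_le.1 hd) hxy hcd))
    by_cases hbn : ∃ b, p i b ∧ b < y
    · obtain ⟨b, ⟨hb, hby⟩, hbmax⟩ := exists_greatest_of_finite hbn
      refine ⟨x, b, hrp _ _ hx, ⟨hp.trans (hp.symm (hrp _ _ hx)) hb, ?_⟩, hix, hxj, by grind⟩
      intro c d hc hcd
      have hpc : p i c := hp.trans (hrp _ _ hx) hc
      have hpd : p i d := hp.trans hpc (hrp _ _ hcd)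
      have h1 := key c d hcd
      have h2 := key d c (hr.symm hcd)
      have h3 : c < y → c ≤ b := fun h => hbmax c ⟨hpc, h⟩
      have h4 : d < y → d ≤ b := fun h => hbmax d ⟨hpd, h⟩
      grind
    -- Nothing in the `p`-class precedes `y`, so the search wraps around to the end of the
    -- `p`-class.
    · obtain ⟨b, hb, hbmax⟩ := exists_greatest_of_finite (P := fun b => p i b) ⟨i, hrp _ _ hri⟩
      have hjb := hbmax j hij
      refine ⟨x, b, hrp _ _ hx, ⟨hp.trans (hp.symm (hrp _ _ hx)) hb, ?_⟩, hix, hxj, by grind⟩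
      intro c d hc hcd
      have hpc : p i c := hp.trans (hrp _ _ hx) hc
      have hpd : p i d := hp.trans hpc (hrp _ _ hcd)
      have h1 := key c d hcd
      have h2 := key d c (hr.symm hcd)
      have h3 : y ≤ c := not_lt.1 fun h => hbn ⟨c, hpc, h⟩
      have h4 : y ≤ d := not_lt.1 fun h => hbn ⟨d, hpd, h⟩
      have h5 := hbmax c hpc
      have h6 := hbmax d hpd
      grind

/-- If `r i j` fails, `exists_krewerasRel_of_not_rel` supplies a complement class cut by `[i, j)`.
If it holds, the defining condition of the complement, applied to the pair `i`, `j`, is a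
rearrangement of what is needed. -/
theorem invKrewerasRel_krewerasRel (hp : IsPER p) (hr : IsPER r) (hrn : NonCrossingRel r)
    (hrp : r ≤ p) (hrefl : ∀ a, p a a → r a a) : InvKrewerasRel p (KrewerasRel p r) = r := by
  have hs : IsPER (InvKrewerasRel p (KrewerasRel p r)) := IsPER.invKrewerasRel hp
  have main : ∀ i j, i < j → (InvKrewerasRel p (KrewerasRel p r) i j ↔ r i j) := fun i j hlt => by
    constructor
    · rintro ⟨hij, h⟩
      by_contra hn
      obtain ⟨a, b, ha, hab, h1, h2, h3⟩ :=
        exists_krewerasRel_of_not_rel hp hr hrn hrp hlt hij (hrefl i (hp.left hij)) hn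
      have := h a b ha hab
      grind
    · refine fun hij => ⟨hrp _ _ hij, fun a b ha hab => ?_⟩
      have := hab.2 i j (hp.symm ha) hij
      grind
  ext i j
  rcases lt_trichotomy i j with h | rfl | h
  · exact main i j h
  · exact ⟨fun h => hrefl _ h.1, fun h => ⟨hrp _ _ h, fun _ _ _ _ => by tauto⟩⟩
  · exact ⟨fun h' => hr.symm ((main j i h).1 (hs.symm h')), fun h' => hs.symm ((main j i h).2 (hr.symm h'))⟩

theorem krewerasRel_invKrewerasRel (hp : IsPER p) (hr : IsPER r) (hrn : NonCrossingRel r)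
    (hrp : r ≤ p) (hrefl : ∀ a, p a a → r a a) : KrewerasRel p (InvKrewerasRel p r) = r :=
  invKrewerasRel_krewerasRel (α := αᵒᵈ) hp hr (hrn.dual hr) hrp hrefl

/-- From right to left, a union of `p`-classes is a union of classes of any finer relation.
Conversely, if `(i, j]` is a union of `r`-classes but cuts a `p`-class, then it also cuts a class of
the complement of `r` inside that `p`-class. -/
theorem krewerasRel_krewerasRel (hp : IsPER p) (hpn : NonCrossingRel p) (hr : IsPER r)
    (hrp : r ≤ p) :
    KrewerasRel (KrewerasRel (fun _ _ => True) r) (KrewerasRel p r) =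
      KrewerasRel (fun _ _ => True) p := by
  have htop : IsPER (fun _ _ : α => True) := ⟨fun _ => trivial, fun _ _ => trivial⟩
  have hk : IsPER (KrewerasRel (fun _ _ => True) r) := IsPER.krewerasRel htop
  have hsk := krewerasRel_le_krewerasRel_top hp hpn hr hrp
  have key : ∀ i j, i ≤ j → KrewerasRel (KrewerasRel (fun _ _ => True) r) (KrewerasRel p r) i j →
      ∀ a b, p a b → i < a → a ≤ j → i < b ∧ b ≤ j := by
    intro i j hle hij a b hab hia haj
    by_contra hb
    obtain ⟨x, ⟨hax, hix, hxj⟩, hxmax⟩ :=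
      exists_greatest_of_finite (P := fun x => p a x ∧ i < x ∧ x ≤ j) ⟨a, hp.left hab, hia, haj⟩
    have hcl : ∀ c d, r c d → i < c → c ≤ j → i < d ∧ d ≤ j := fun c d hcd h1 h2 => by
      have := hij.1.2 c d trivial hcd
      grind
    -- The sought `y` is the last point of the `p`-class at or below `i`, or its greatest point if
    -- there is none. Between `x` and `y` the `p`-class is then cut exactly along `(i, j]`.
    suffices h : ∃ y, KrewerasRel p r x y ∧ ¬ (i < y ∧ y ≤ j) by
      obtain ⟨y, hxy, hy⟩ := h
      have hxyk := hsk _ _ hxy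
      have hixk : KrewerasRel (fun _ _ => True) r i x := by
        refine ⟨trivial, fun c d _ hcd => ?_⟩
        have h1 := hxyk.2 c d trivial hcd
        have h2 := hcl c d hcd
        have h3 := hcl d c (hr.symm hcd)
        grind
      have := hij.2 x y hixk hxy
      grind
    by_cases hy : ∃ y, p a y ∧ y ≤ i
    · obtain ⟨y, ⟨hay, hyi⟩, hymax⟩ := exists_greatest_of_finite hy
      refine ⟨y, ⟨hp.trans (hp.symm hax) hay, fun c d hc hcd => ?_⟩, by grind⟩
      have hac := hp.trans hax hc
      have had := hp.trans hac (hrp _ _ hcd)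
      have h1 := hcl c d hcd
      have h2 := hcl d c (hr.symm hcd)
      have h3 := hxmax c
      have h4 := hxmax d
      have h5 := hymax c
      have h6 := hymax d
      grind
    · obtain ⟨y, hay, hymax⟩ := exists_greatest_of_finite (P := fun y => p a y) ⟨b, hab⟩
      have hby := hymax b hab
      have hbi : i < b := not_le.1 fun h => hy ⟨b, hab, h⟩
      refine ⟨y, ⟨hp.trans (hp.symm hax) hay, fun c d hc hcd => ?_⟩, by grind⟩
      have hac := hp.trans hax hc
      have had := hp.trans hac (hrp _ _ hcd)
      have h1 := hcl c d hcd
      have h2 := hcl d c (hr.symm hcd)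
      have h3 := hxmax c
      have h4 := hxmax d
      have h5 := hymax c hac
      have h6 := hymax d had
      have h7 : i < c := not_le.1 fun h => hy ⟨c, hac, h⟩
      have h8 : i < d := not_le.1 fun h => hy ⟨d, had, h⟩
      grind
  ext i j
  constructor
  · intro hij
    have hij' := (IsPER.krewerasRel hk).symm hij
    refine ⟨trivial, fun a b _ hab => ?_⟩
    rcases le_total i j with hle | hle
    · have h1 := key i j hle hij a b hab
      have h2 := key i j hle hij b a (hp.symm hab)
      grind
    · have h1 := key j i hle hij' a b hab
      have h2 := key j i hle hij' b a (hp.symm hab)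
      grind
  · rintro ⟨-, h⟩
    exact ⟨⟨trivial, fun a b _ hab => h a b trivial (hrp _ _ hab)⟩,
      fun a b _ hab => h a b trivial hab.1⟩

end KrewerasRel

/-! ### Partitions of finite subsets of a linear order -/

namespace Finpartition

section Rel

variable {α : Type*} [DecidableEq α] {S : Finset α}

/-- Two points lie in a common block of `P`. -/
def Rel (P : Finpartition S) (a b : α) : Prop := ∃ V ∈ P.parts, a ∈ V ∧ b ∈ V

theorem rel_iff_of_mem (P : Finpartition S) {V : Finset α} (hV : V ∈ P.parts) {a b : α}
    (ha : a ∈ V) : P.Rel a b ↔ b ∈ V :=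
  ⟨fun ⟨_, hW, haW, hb⟩ => P.eq_of_mem_parts hV hW ha haW ▸ hb, fun hb => ⟨V, hV, ha, hb⟩⟩

theorem rel_isPER (P : Finpartition S) : IsPER P.Rel where
  symm := fun ⟨V, hV, ha, hb⟩ => ⟨V, hV, hb, ha⟩
  trans := fun ⟨V, hV, ha, hb⟩ hbc => ⟨V, hV, ha, (P.rel_iff_of_mem hV hb).1 hbc⟩

theorem Rel.left_mem {P : Finpartition S} {a b : α} (h : P.Rel a b) : a ∈ S := by
  obtain ⟨V, hV, ha, -⟩ := h
  exact P.subset hV ha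

theorem Rel.right_mem {P : Finpartition S} {a b : α} (h : P.Rel a b) : b ∈ S :=
  (P.rel_isPER.symm h).left_mem

theorem rel_self (P : Finpartition S) {a : α} : P.Rel a a ↔ a ∈ S :=
  ⟨Rel.left_mem, fun ha => let ⟨V, hV, h⟩ := P.exists_mem ha; ⟨V, hV, h, h⟩⟩

theorem mem_parts_iff_rel (P : Finpartition S) {V : Finset α} :
    V ∈ P.parts ↔ ∃ a ∈ S, ∀ b, b ∈ V ↔ P.Rel a b := by
  constructor
  · intro hV
    obtain ⟨a, ha⟩ := P.nonempty_of_mem_parts hV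
    exact ⟨a, P.subset hV ha, fun b => (P.rel_iff_of_mem hV ha).symm⟩
  · rintro ⟨a, ha, h⟩
    obtain ⟨W, hW, haW⟩ := P.exists_mem ha
    have : V = W := by
      ext b
      rw [h, P.rel_iff_of_mem hW haW]
    exact this ▸ hW

theorem ext_rel {P Q : Finpartition S} (h : ∀ a b, P.Rel a b ↔ Q.Rel a b) : P = Q := by
  ext V
  simp only [mem_parts_iff_rel, h]

open Classical in
/-- The partition of `S` into the classes of a relation. -/
noncomputable def ofPER (S : Finset α) (r : α → α → Prop) (hr : IsPER r)
    (hS : ∀ a, r a a ↔ a ∈ S) : Finpartition S :=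
  ofExistsUnique (S.image fun a => S.filter (r a))
    (by
      simp only [mem_image, forall_exists_index, and_imp]
      rintro _ a - rfl
      exact filter_subset _ _)
    (by
      intro a ha
      refine ⟨S.filter (r a), ⟨mem_image_of_mem _ ha, mem_filter.2 ⟨ha, (hS a).2 ha⟩⟩, ?_⟩
      simp only [mem_image, and_imp, forall_exists_index]
      rintro _ b - rfl hab
      have hba := (mem_filter.1 hab).2
      ext c
      simp only [mem_filter]
      exact and_congr_right fun _ => ⟨hr.trans (hr.symm hba), hr.trans hba⟩)
    (by
      simp only [mem_image, not_exists, not_and]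
      intro a ha h
      exact notMem_empty a (h ▸ mem_filter.2 ⟨ha, (hS a).2 ha⟩))

theorem rel_ofPER {r : α → α → Prop} (hr : IsPER r) (hS : ∀ a, r a a ↔ a ∈ S) :
    (ofPER S r hr hS).Rel = r := by
  classical
  ext a b
  simp only [Rel, ofPER, ofExistsUnique, mem_image]
  constructor
  · rintro ⟨_, ⟨c, -, rfl⟩, ha, hb⟩
    exact hr.trans (hr.symm (mem_filter.1 ha).2) (mem_filter.1 hb).2
  · intro h
    have ha := (hS a).1 (hr.left h)
    exact ⟨_, ⟨a, ha, rfl⟩, mem_filter.2 ⟨ha, hr.left h⟩, mem_filter.2 ⟨(hS b).1 (hr.right h), h⟩⟩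

theorem isPER_mem_and_mem {α : Type*} (S : Finset α) : IsPER fun a b => a ∈ S ∧ b ∈ S :=
  ⟨fun h => ⟨h.2, h.1⟩, fun h h' => ⟨h.1, h'.2⟩⟩

theorem rel_bind (P : Finpartition S) (Q : ∀ V ∈ P.parts, Finpartition V) (a b : α) :
    (P.bind Q).Rel a b ↔ ∃ V hV, (Q V hV).Rel a b := by
  simp only [Rel, mem_bind]
  aesop

theorem rel_bind_of_mem (P : Finpartition S) (Q : ∀ V ∈ P.parts, Finpartition V)
    {V : Finset α} (hV : V ∈ P.parts) {a b : α} (ha : a ∈ V) :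
    (P.bind Q).Rel a b ↔ (Q V hV).Rel a b := by
  rw [rel_bind]
  refine ⟨fun ⟨W, hW, h⟩ => ?_, fun h => ⟨V, hV, h⟩⟩
  obtain rfl := P.eq_of_mem_parts hV hW ha h.left_mem
  exact h

theorem prod_parts_bind {M : Type*} [CommMonoid M] (P : Finpartition S)
    (Q : ∀ V ∈ P.parts, Finpartition V) (F : Finset α → M) :
    ∏ W ∈ (P.bind Q).parts, F W = ∏ V ∈ P.parts.attach, ∏ W ∈ (Q V.1 V.2).parts, F W := by
  have h : (P.bind Q).parts = P.parts.attach.biUnion fun V => (Q V.1 V.2).parts := by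
    ext W
    simp
  rw [h, prod_biUnion]
  intro V _ V' _ hne
  refine disjoint_left.2 fun W hW hW' => hne (Subtype.ext ?_)
  obtain ⟨a, ha⟩ := (Q V.1 V.2).nonempty_of_mem_parts hW
  exact P.eq_of_mem_parts V.2 V'.2 ((Q V.1 V.2).subset hW ha) ((Q V'.1 V'.2).subset hW' ha)

end Rel

/-! ### Non-crossing partitions of finite sets and their relative complements. -/

section Order

variable {α : Type*} [LinearOrder α] {S : Finset α}

/-- The non-crossing partitions of a finite subset of a linear order. -/
noncomputable def nonCrossing (S : Finset α) : Finset (Finpartition S) :=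
  open Classical in univ.filter fun P => NonCrossingRel P.Rel

theorem mem_nonCrossing {P : Finpartition S} : P ∈ nonCrossing S ↔ NonCrossingRel P.Rel := by
  simp [nonCrossing]

/-- The Kreweras complement of `Q` inside each block of `P`. -/
noncomputable def relKreweras (P Q : Finpartition S) : Finpartition S :=
  ofPER S (KrewerasRel P.Rel Q.Rel) P.rel_isPER.krewerasRel fun _ =>
    ⟨fun h => P.rel_self.1 h.1, fun h => krewerasRel_self (P.rel_self.2 h)⟩

/-- The inverse Kreweras complement of `Q` inside each block of `P`. -/
noncomputable def relInvKreweras (P Q : Finpartition S) : Finpartition S :=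
  ofPER S (InvKrewerasRel P.Rel Q.Rel) P.rel_isPER.invKrewerasRel fun _ =>
    ⟨fun h => P.rel_self.1 h.1, fun h => krewerasRel_self (α := αᵒᵈ) (P.rel_self.2 h)⟩

/-- The Kreweras complement of a partition of `S`. -/
noncomputable def complement (P : Finpartition S) : Finpartition S :=
  ofPER S (KrewerasRel (fun a b => a ∈ S ∧ b ∈ S) P.Rel) (isPER_mem_and_mem S).krewerasRel fun _ =>
    ⟨fun h => h.1.1, fun h => krewerasRel_self ⟨h, h⟩⟩

/-- The inverse Kreweras complement of a partition of `S`. -/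
noncomputable def invComplement (P : Finpartition S) : Finpartition S :=
  ofPER S (InvKrewerasRel (fun a b => a ∈ S ∧ b ∈ S) P.Rel) (isPER_mem_and_mem S).invKrewerasRel
    fun _ => ⟨fun h => h.1.1, fun h =>
      krewerasRel_self (α := αᵒᵈ) (p := fun a b => a ∈ S ∧ b ∈ S) ⟨h, h⟩⟩

theorem rel_relKreweras (P Q : Finpartition S) :
    (P.relKreweras Q).Rel = KrewerasRel P.Rel Q.Rel := rel_ofPER _ _

theorem rel_relInvKreweras (P Q : Finpartition S) :
    (P.relInvKreweras Q).Rel = InvKrewerasRel P.Rel Q.Rel := rel_ofPER _ _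

theorem rel_complement (P : Finpartition S) :
    P.complement.Rel = KrewerasRel (fun a b => a ∈ S ∧ b ∈ S) P.Rel := rel_ofPER _ _

theorem rel_invComplement (P : Finpartition S) :
    P.invComplement.Rel = InvKrewerasRel (fun a b => a ∈ S ∧ b ∈ S) P.Rel := rel_ofPER _ _

theorem relKreweras_rel_le (P Q : Finpartition S) : (P.relKreweras Q).Rel ≤ P.Rel := by
  rw [rel_relKreweras]
  exact fun _ _ h => h.1

theorem rel_le_mem (P : Finpartition S) : P.Rel ≤ fun a b => a ∈ S ∧ b ∈ S :=
  fun _ _ h => ⟨h.left_mem, h.right_mem⟩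

theorem nonCrossingRel_mem_and_mem (S : Finset α) : NonCrossingRel fun a b => a ∈ S ∧ b ∈ S :=
  fun _ _ _ _ _ _ _ h h' => ⟨h.1, h'.1⟩

theorem complement_mem_nonCrossing (P : Finpartition S) : P.complement ∈ nonCrossing S := by
  rw [mem_nonCrossing, rel_complement]
  exact NonCrossingRel.krewerasRel (isPER_mem_and_mem S) (nonCrossingRel_mem_and_mem S)

theorem invComplement_mem_nonCrossing (P : Finpartition S) : P.invComplement ∈ nonCrossing S := by
  rw [mem_nonCrossing, rel_invComplement]
  exact NonCrossingRel.invKrewerasRel (isPER_mem_and_mem S) (nonCrossingRel_mem_and_mem S)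

theorem relKreweras_mem_nonCrossing {P : Finpartition S} (hP : P ∈ nonCrossing S)
    (Q : Finpartition S) : P.relKreweras Q ∈ nonCrossing S := by
  rw [mem_nonCrossing, rel_relKreweras]
  exact NonCrossingRel.krewerasRel P.rel_isPER (mem_nonCrossing.1 hP)

theorem invComplement_complement [Finite α] {P : Finpartition S} (hP : P ∈ nonCrossing S) :
    P.complement.invComplement = P := ext_rel fun a b => by
  rw [rel_invComplement, rel_complement, invKrewerasRel_krewerasRel (isPER_mem_and_mem S)
    P.rel_isPER (mem_nonCrossing.1 hP) P.rel_le_mem fun a h => P.rel_self.2 h.1]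

theorem relInvKreweras_relKreweras [Finite α] {P Q : Finpartition S} (hQ : Q ∈ nonCrossing S)
    (h : Q.Rel ≤ P.Rel) : P.relInvKreweras (P.relKreweras Q) = Q := ext_rel fun a b => by
  rw [rel_relInvKreweras, rel_relKreweras, invKrewerasRel_krewerasRel P.rel_isPER
    Q.rel_isPER (mem_nonCrossing.1 hQ) h fun a h => Q.rel_self.2 (P.rel_self.1 h)]

theorem relKreweras_relInvKreweras [Finite α] {P Q : Finpartition S} (hQ : Q ∈ nonCrossing S)
    (h : Q.Rel ≤ P.Rel) : P.relKreweras (P.relInvKreweras Q) = Q := ext_rel fun a b => by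
  rw [rel_relKreweras, rel_relInvKreweras, krewerasRel_invKrewerasRel P.rel_isPER
    Q.rel_isPER (mem_nonCrossing.1 hQ) h fun a h => Q.rel_self.2 (P.rel_self.1 h)]

section Univ

variable [Fintype α] {P Q : Finpartition (univ : Finset α)}

theorem rel_complement_univ (P : Finpartition (univ : Finset α)) :
    P.complement.Rel = KrewerasRel (fun _ _ => True) P.Rel := by
  simp [rel_complement]

theorem rel_invComplement_univ (P : Finpartition (univ : Finset α)) :
    P.invComplement.Rel = InvKrewerasRel (fun _ _ => True) P.Rel := by
  simp [rel_invComplement]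

theorem relKreweras_le_complement (hP : P ∈ nonCrossing univ) (h : Q.Rel ≤ P.Rel) :
    (P.relKreweras Q).Rel ≤ Q.complement.Rel := by
  rw [rel_relKreweras, rel_complement_univ]
  exact krewerasRel_le_krewerasRel_top P.rel_isPER (mem_nonCrossing.1 hP) Q.rel_isPER h

theorem relKreweras_relKreweras (hP : P ∈ nonCrossing univ) (h : Q.Rel ≤ P.Rel) :
    Q.complement.relKreweras (P.relKreweras Q) = P.complement := ext_rel fun a b => by
  rw [rel_relKreweras, rel_relKreweras, rel_complement_univ, rel_complement_univ,
    krewerasRel_krewerasRel P.rel_isPER (mem_nonCrossing.1 hP) Q.rel_isPER h]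

theorem relInvKreweras_le_invComplement (hP : P ∈ nonCrossing univ) (h : Q.Rel ≤ P.Rel) :
    (P.relInvKreweras Q).Rel ≤ Q.invComplement.Rel := by
  rw [rel_relInvKreweras, rel_invComplement_univ]
  exact krewerasRel_le_krewerasRel_top (α := αᵒᵈ) P.rel_isPER
    ((mem_nonCrossing.1 hP).dual P.rel_isPER) Q.rel_isPER h

theorem relInvKreweras_relInvKreweras (hP : P ∈ nonCrossing univ) (h : Q.Rel ≤ P.Rel) :
    Q.invComplement.relInvKreweras (P.relInvKreweras Q) = P.invComplement := ext_rel fun a b => by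
  rw [rel_relInvKreweras, rel_relInvKreweras, rel_invComplement_univ, rel_invComplement_univ]
  exact iff_of_eq (congrFun (congrFun (krewerasRel_krewerasRel (α := αᵒᵈ) P.rel_isPER
    ((mem_nonCrossing.1 hP).dual P.rel_isPER) Q.rel_isPER h) a) b)

/-- Chains `Q ≤ P` of non-crossing partitions correspond to pairs `Q`, `σ ≤ K(Q)`. -/
theorem sum_nonCrossing_relKreweras {M : Type*} [AddCommMonoid M]
    (F : Finpartition (univ : Finset α) → Finpartition (univ : Finset α) →
      Finpartition (univ : Finset α) → M) :
    open Classical in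
    ∑ P ∈ nonCrossing univ, ∑ Q ∈ (nonCrossing univ).filter (fun Q => Q.Rel ≤ P.Rel),
        F Q (P.relKreweras Q) P.complement =
      ∑ Q ∈ nonCrossing univ, ∑ σ ∈ (nonCrossing univ).filter (fun σ => σ.Rel ≤ Q.complement.Rel),
        F Q σ (Q.complement.relKreweras σ) := by
  classical
  rw [sum_sigma', sum_sigma']
  -- The inverse map must recover `P` from `Q` and `σ`. As `K(P)` should be `K_{K(Q)}(σ)`, the
  -- candidate is the inverse complement of the latter; the order-reversed identities show that `Q`
  -- lies below it and has `σ` as relative complement.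
  have hb : ∀ x : (_ : Finpartition (univ : Finset α)) × Finpartition (univ : Finset α),
      x.1 ∈ nonCrossing univ → x.2 ∈ nonCrossing univ → x.2.Rel ≤ x.1.complement.Rel →
      x.1.Rel ≤ (x.1.complement.relKreweras x.2).invComplement.Rel ∧
      (x.1.complement.relKreweras x.2).invComplement.relKreweras x.1 = x.2 := by
    rintro ⟨Q, σ⟩ hQ hσ hle
    dsimp only at hQ hσ hle ⊢
    have hτ := Q.complement.relKreweras_rel_le σ
    have h1 := relInvKreweras_le_invComplement Q.complement_mem_nonCrossing hτ
    have h2 := relInvKreweras_relInvKreweras Q.complement_mem_nonCrossing hτ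
    rw [relInvKreweras_relKreweras hσ hle] at h1 h2
    rw [invComplement_complement hQ] at h2
    have h2' := congrArg Rel h2
    have h3 := relKreweras_relInvKreweras hσ h1
    rw [h2] at h3
    refine ⟨?_, h3⟩
    rw [rel_relInvKreweras] at h2'
    exact fun a b h => ((iff_of_eq (congrFun (congrFun h2' a) b)).2 h).1
  refine sum_bij' (fun x _ => ⟨x.2, x.1.relKreweras x.2⟩)
    (fun x _ => ⟨(x.1.complement.relKreweras x.2).invComplement, x.1⟩) ?_ ?_ ?_ ?_ ?_
  · rintro ⟨P, Q⟩ h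
    simp only [mem_sigma, mem_filter] at h ⊢
    exact ⟨h.2.1, relKreweras_mem_nonCrossing h.1 Q, relKreweras_le_complement h.1 h.2.2⟩
  · rintro ⟨Q, σ⟩ h
    simp only [mem_sigma, mem_filter] at h ⊢
    exact ⟨invComplement_mem_nonCrossing _, h.1, (hb ⟨Q, σ⟩ h.1 h.2.1 h.2.2).1⟩
  · rintro ⟨P, Q⟩ h
    simp only [mem_sigma, mem_filter] at h ⊢
    rw [relKreweras_relKreweras h.1 h.2.2, invComplement_complement h.1]
  · rintro ⟨Q, σ⟩ h
    simp only [mem_sigma, mem_filter] at h ⊢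
    rw [(hb ⟨Q, σ⟩ h.1 h.2.1 h.2.2).2]
  · rintro ⟨P, Q⟩ h
    simp only [mem_sigma, mem_filter] at h ⊢
    rw [relKreweras_relKreweras h.1 h.2.2]

end Univ

theorem bind_mem_nonCrossing {P : Finpartition S} (hP : P ∈ nonCrossing S)
    (Q : ∀ V ∈ P.parts, Finpartition V) (hQ : ∀ V hV, Q V hV ∈ nonCrossing V) :
    P.bind Q ∈ nonCrossing S := by
  rw [mem_nonCrossing] at hP ⊢
  intro a b c d hab hbc hcd hac hbd
  obtain ⟨V, hV, hac'⟩ := (P.rel_bind Q a c).1 hac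
  obtain ⟨W, hW, hbd'⟩ := (P.rel_bind Q b d).1 hbd
  have hPab := hP a b c d hab hbc hcd ⟨V, hV, hac'.left_mem, hac'.right_mem⟩
    ⟨W, hW, hbd'.left_mem, hbd'.right_mem⟩
  have hbV := (P.rel_iff_of_mem hV hac'.left_mem).1 hPab
  rw [rel_bind_of_mem P Q hV hbV] at hbd
  exact (rel_bind_of_mem P Q hV hac'.left_mem).2
    (mem_nonCrossing.1 (hQ V hV) a b c d hab hbc hcd hac' hbd)

theorem relKreweras_bind (P : Finpartition S) (Q : ∀ V ∈ P.parts, Finpartition V) :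
    P.relKreweras (P.bind Q) = P.bind fun V hV => (Q V hV).complement := ext_rel fun i j => by
  by_cases hi : i ∈ S
  · obtain ⟨V, hV, hiV⟩ := P.exists_mem hi
    rw [rel_bind_of_mem _ _ hV hiV, rel_relKreweras, rel_complement]
    refine and_congr (by simp [P.rel_iff_of_mem hV hiV, hiV]) (forall₂_congr fun a b => ?_)
    simp only [P.rel_iff_of_mem hV hiV, hiV, true_and]
    exact imp_congr_right fun ha => by rw [rel_bind_of_mem _ _ hV ha]
  · exact iff_of_false (fun h => hi h.left_mem) (fun h => hi h.left_mem)

theorem le_of_bind (P : Finpartition S) (Q : ∀ V ∈ P.parts, Finpartition V) :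
    (P.bind Q).Rel ≤ P.Rel := fun a b h => by
  obtain ⟨V, hV, h⟩ := (P.rel_bind Q a b).1 h
  exact ⟨V, hV, h.left_mem, h.right_mem⟩

/-- The partition of `V` induced by a partition of `S`, for `V ⊆ S`. -/
noncomputable def induced (Q : Finpartition S) {V : Finset α} (hV : V ⊆ S) : Finpartition V :=
  ofPER V (fun a b => a ∈ V ∧ b ∈ V ∧ Q.Rel a b)
    ⟨fun h => ⟨h.2.1, h.1, Q.rel_isPER.symm h.2.2⟩,
      fun h h' => ⟨h.1, h'.2.1, Q.rel_isPER.trans h.2.2 h'.2.2⟩⟩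
    fun _ => ⟨fun h => h.1, fun h => ⟨h, h, Q.rel_self.2 (hV h)⟩⟩

theorem rel_induced (Q : Finpartition S) {V : Finset α} (hV : V ⊆ S) (a b : α) :
    (Q.induced hV).Rel a b ↔ a ∈ V ∧ b ∈ V ∧ Q.Rel a b := by
  rw [induced, rel_ofPER]

/-- Choosing a non-crossing partition of every block of `P` amounts to choosing a non-crossing `Q ≤
P`, and the blockwise complements glue to the relative complement. -/
theorem prod_sum_nonCrossing {R : Type*} [CommSemiring R] {P : Finpartition S}
    (hP : P ∈ nonCrossing S) (F G : Finset α → R) :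
    open Classical in
    ∏ V ∈ P.parts, ∑ Q ∈ nonCrossing V, (∏ W ∈ Q.parts, F W) * ∏ W ∈ Q.complement.parts, G W =
      ∑ Q ∈ (nonCrossing S).filter (fun Q => Q.Rel ≤ P.Rel),
        (∏ W ∈ Q.parts, F W) * ∏ W ∈ (P.relKreweras Q).parts, G W := by
  classical
  rw [prod_sum]
  refine sum_bij' (fun Q _ => P.bind Q) (fun Q _ V hV => Q.induced (P.subset hV)) ?_ ?_ ?_ ?_ ?_
  · intro Q hQ
    rw [mem_pi] at hQ
    exact mem_filter.2 ⟨bind_mem_nonCrossing hP Q hQ, P.le_of_bind Q⟩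
  · intro Q hQ
    rw [mem_filter, mem_nonCrossing] at hQ
    rw [mem_pi]
    intro V hV
    rw [mem_nonCrossing]
    intro a b c d hab hbc hcd hac hbd
    rw [rel_induced] at *
    exact ⟨hac.1, hbd.1, hQ.1 a b c d hab hbc hcd hac.2.2 hbd.2.2⟩
  · intro Q hQ
    ext1 V
    ext1 hV
    refine ext_rel fun a b => ?_
    rw [rel_induced]
    constructor
    · rintro ⟨ha, hb, h⟩
      exact (rel_bind_of_mem P Q hV ha).1 h
    · exact fun h => ⟨h.left_mem, h.right_mem, (rel_bind_of_mem P Q hV h.left_mem).2 h⟩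
  · intro Q hQ
    rw [mem_filter] at hQ
    refine ext_rel fun a b => ?_
    simp only [rel_bind, rel_induced]
    constructor
    · rintro ⟨V, hV, -, -, h⟩
      exact h
    · intro h
      obtain ⟨V, hV, ha, hb⟩ := hQ.2 _ _ h
      exact ⟨V, hV, ha, hb, h⟩
  · intro Q hQ
    rw [relKreweras_bind, prod_parts_bind, prod_parts_bind, prod_mul_distrib]

end Order

end Finpartition

/-! ### The boxed convolution as a sum over partitions of a linearly ordered set -/

theorem sameBlock_iff_rel {m : ℕ} (P : Finpartition (univ : Finset (Fin m))) (a b : Fin m) :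
    SameBlock P a b ↔ P.Rel a b := by
  rw [SameBlock, ← P.mem_part_iff_part_eq_part (mem_univ a) (mem_univ b),
    Finpartition.mem_part_iff_exists]
  rfl

theorem nC_eq_nonCrossing (m : ℕ) : NC m = Finpartition.nonCrossing univ := by
  ext P
  have h : SameBlock P = P.Rel := by
    ext a b
    exact sameBlock_iff_rel P a b
  simp [NC, Finpartition.nonCrossing, h]

theorem kreweras_eq_complement {m : ℕ} (P : Finpartition (univ : Finset (Fin m))) :
    kreweras P = P.complement := Finpartition.ext_rel fun a b => by
  simp only [← sameBlock_iff_rel, sameBlock_kreweras]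
  simp only [sameBlock_iff_rel, Finpartition.rel_complement_univ, KrewerasRel, true_and,
    true_implies]

/-! ### Transport of non-crossing partitions along order embeddings. -/

namespace Finpartition

variable {α β : Type*} [LinearOrder α] [LinearOrder β]

/-- The image of a partition under an injective map. -/
noncomputable def push (e : β ↪ α) {T : Finset β} (Q : Finpartition T) :
    Finpartition (T.map e) :=
  ofPER (T.map e) (fun a b => ∃ i j, e i = a ∧ e j = b ∧ Q.Rel i j)
    ⟨fun ⟨i, j, hi, hj, h⟩ => ⟨j, i, hj, hi, Q.rel_isPER.symm h⟩,
      fun ⟨i, j, hi, hj, h⟩ ⟨j', l, hj', hl, h'⟩ =>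
        ⟨i, l, hi, hl, Q.rel_isPER.trans h (e.injective (hj'.trans hj.symm) ▸ h')⟩⟩
    fun a => by
      rw [mem_map]
      exact ⟨fun ⟨i, j, hi, _, h⟩ => ⟨i, h.left_mem, hi⟩,
        fun ⟨i, hi, h⟩ => ⟨i, i, h, h, Q.rel_self.2 hi⟩⟩

theorem rel_push (e : β ↪ α) {T : Finset β} (Q : Finpartition T) (i j : β) :
    (Q.push e).Rel (e i) (e j) ↔ Q.Rel i j := by
  rw [push, rel_ofPER]
  constructor
  · rintro ⟨i', j', hi, hj, h⟩
    rwa [← e.injective hi, ← e.injective hj]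
  · exact fun h => ⟨i, j, rfl, rfl, h⟩

/-- The preimage of a partition under an injective map. -/
noncomputable def pull (e : β ↪ α) {T : Finset β} (P : Finpartition (T.map e)) :
    Finpartition T :=
  ofPER T (fun i j => P.Rel (e i) (e j)) ⟨P.rel_isPER.symm, P.rel_isPER.trans⟩ fun i => by
    rw [P.rel_self, mem_map' e]

theorem rel_pull (e : β ↪ α) {T : Finset β} (P : Finpartition (T.map e)) (i j : β) :
    (P.pull e).Rel i j ↔ P.Rel (e i) (e j) := by
  rw [pull, rel_ofPER]

theorem ext_rel_map {β : Type*} {e : β ↪ α} {T : Finset β} {P Q : Finpartition (T.map e)}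
    (h : ∀ i ∈ T, ∀ j ∈ T, P.Rel (e i) (e j) ↔ Q.Rel (e i) (e j)) : P = Q :=
  ext_rel fun a b => by
    by_cases ha : a ∈ T.map e
    · by_cases hb : b ∈ T.map e
      · obtain ⟨i, hi, rfl⟩ := mem_map.1 ha
        obtain ⟨j, hj, rfl⟩ := mem_map.1 hb
        exact h i hi j hj
      · exact iff_of_false (fun h => hb h.right_mem) fun h => hb h.right_mem
    · exact iff_of_false (fun h => ha h.left_mem) fun h => ha h.left_mem

theorem parts_push (e : β ↪ α) {T : Finset β} (Q : Finpartition T) :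
    (Q.push e).parts = Q.parts.map (mapEmbedding e).toEmbedding := by
  ext V
  rw [mem_map, mem_parts_iff_rel]
  constructor
  · rintro ⟨a, ha, hV⟩
    obtain ⟨i, hi, rfl⟩ := mem_map.1 ha
    obtain ⟨W, hW, hiW⟩ := Q.exists_mem hi
    refine ⟨W, hW, ?_⟩
    ext b
    rw [hV]
    change b ∈ W.map e ↔ _
    rw [mem_map]
    constructor
    · rintro ⟨j, hj, rfl⟩
      exact (Q.rel_push e i j).2 ((Q.rel_iff_of_mem hW hiW).2 hj)
    · intro h
      obtain ⟨j, -, rfl⟩ := mem_map.1 h.right_mem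
      exact ⟨j, (Q.rel_iff_of_mem hW hiW).1 ((Q.rel_push e i j).1 h), rfl⟩
  · rintro ⟨W, hW, rfl⟩
    obtain ⟨i, hi⟩ := Q.nonempty_of_mem_parts hW
    refine ⟨e i, mem_map_of_mem e (Q.subset hW hi), fun b => ?_⟩
    change b ∈ W.map e ↔ _
    rw [mem_map]
    constructor
    · rintro ⟨j, hj, rfl⟩
      exact (Q.rel_push e i j).2 ((Q.rel_iff_of_mem hW hi).2 hj)
    · intro h
      obtain ⟨j, -, rfl⟩ := mem_map.1 h.right_mem
      exact ⟨j, (Q.rel_iff_of_mem hW hi).1 ((Q.rel_push e i j).1 h), rfl⟩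

theorem push_mem_nonCrossing (e : β ↪o α) {T : Finset β} {Q : Finpartition T}
    (hQ : Q ∈ nonCrossing T) : Q.push e.toEmbedding ∈ nonCrossing (T.map e.toEmbedding) := by
  rw [mem_nonCrossing] at hQ ⊢
  intro a b c d hab hbc hcd hac hbd
  obtain ⟨i, -, rfl⟩ := mem_map.1 hac.left_mem
  obtain ⟨j, -, rfl⟩ := mem_map.1 hbd.left_mem
  obtain ⟨k, -, rfl⟩ := mem_map.1 hac.right_mem
  obtain ⟨l, -, rfl⟩ := mem_map.1 hbd.right_mem
  rw [rel_push] at *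
  exact hQ i j k l (e.lt_iff_lt.1 hab) (e.lt_iff_lt.1 hbc) (e.lt_iff_lt.1 hcd) hac hbd

theorem pull_mem_nonCrossing (e : β ↪o α) {T : Finset β}
    {P : Finpartition (T.map e.toEmbedding)} (hP : P ∈ nonCrossing (T.map e.toEmbedding)) :
    P.pull e.toEmbedding ∈ nonCrossing T := by
  rw [mem_nonCrossing] at hP ⊢
  intro i j k l hij hjk hkl hik hjl
  rw [rel_pull] at *
  exact hP _ _ _ _ (e.lt_iff_lt.2 hij) (e.lt_iff_lt.2 hjk) (e.lt_iff_lt.2 hkl) hik hjl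

theorem complement_push (e : β ↪o α) {T : Finset β} (Q : Finpartition T) :
    (Q.push e.toEmbedding).complement = Q.complement.push e.toEmbedding :=
  ext_rel_map fun i hi j hj => by
    rw [rel_push, rel_complement, rel_complement]
    refine and_congr (by simp) ?_
    constructor
    · intro h a b ha hab
      have := h (e a) (e b) (by simpa using ha) ((Q.rel_push _ _ _).2 hab)
      simpa using this
    · intro h a b ha hab
      obtain ⟨a, -, rfl⟩ := mem_map.1 ha.2
      obtain ⟨b, -, rfl⟩ := mem_map.1 hab.right_mem
      have := h a b (by simpa using ha) ((Q.rel_push _ _ _).1 hab)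
      simpa using this

theorem sum_nonCrossing_map {M : Type*} [AddCommMonoid M] (e : β ↪o α) (T : Finset β)
    (F : Finpartition (T.map e.toEmbedding) → M) :
    ∑ P ∈ nonCrossing (T.map e.toEmbedding), F P =
      ∑ Q ∈ nonCrossing T, F (Q.push e.toEmbedding) := by
  refine (sum_bij' (fun Q _ => Q.push e.toEmbedding) (fun P _ => P.pull e.toEmbedding)
    (fun Q hQ => push_mem_nonCrossing e hQ) (fun P hP => pull_mem_nonCrossing e hP) ?_ ?_
    fun _ _ => rfl).symm
  · exact fun Q _ => ext_rel fun i j => by rw [rel_pull, rel_push]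
  · exact fun P _ => ext_rel_map fun i _ j _ => by rw [rel_push, rel_pull]

end Finpartition

/-! ### Associativity of the boxed convolution. -/

section BoxConv

open Finpartition

variable {s : ℕ} {R : Type*} [CommRing R]

theorem boxConv_nil (f g : NCSeries s R) : boxConv f g [] = 0 := by simp [boxConv]

theorem boxConv_of_ne_nil (f g : NCSeries s R) {w : List (Fin s)} (hw : w ≠ []) :
    boxConv f g w = ∑ P ∈ nonCrossing (univ : Finset (Fin w.length)),
      (∏ V ∈ P.parts, f (V.sort.map w.get)) * ∏ V ∈ P.complement.parts, g (V.sort.map w.get) := by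
  simp only [boxConv, if_neg hw, nC_eq_nonCrossing, kreweras_eq_complement, blockCoeff]

theorem sort_map_orderEmbedding {α β : Type*} [LinearOrder α] [LinearOrder β] (e : β ↪o α)
    (V : Finset β) : (V.map e.toEmbedding).sort = V.sort.map e := by
  symm
  exact Finset.map_sort _ _ _ _ fun a _ b _ => e.le_iff_le.symm

/-- Iterating the convolution requires its formula on the blocks of a partition, which are subsets
and not initial segments. The increasing enumeration of `S` transports the definition. -/
theorem boxConv_sort {α : Type*} [LinearOrder α] (f g : NCSeries s R) (x : α → Fin s)
    {S : Finset α} (hS : S.Nonempty) :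
    boxConv f g (S.sort.map x) = ∑ P ∈ nonCrossing S,
      (∏ V ∈ P.parts, f (V.sort.map x)) * ∏ V ∈ P.complement.parts, g (V.sort.map x) := by
  have hw : S.sort.map x ≠ [] := by
    obtain ⟨a, ha⟩ := hS
    exact List.ne_nil_of_mem (List.mem_map_of_mem ((mem_sort _).2 ha))
  rw [boxConv_of_ne_nil f g hw]
  have hlen : (S.sort.map x).length = S.card := by simp
  generalize hW : S.sort.map x = w at *
  let e : Fin w.length ↪o α := S.orderEmbOfFin hlen.symm
  have he : univ.map e.toEmbedding = S := by
    simp [e]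
  have hx : ∀ i, w.get i = x (e i) := by
    subst hW
    intro i
    simp [e, Finset.orderEmbOfFin_apply]
  have hs : ∀ V : Finset (Fin w.length),
      ((mapEmbedding e.toEmbedding).toEmbedding V).sort.map x = V.sort.map w.get := fun V => by
    change (V.map e.toEmbedding).sort.map x = _
    rw [sort_map_orderEmbedding, List.map_map]
    exact List.map_congr_left fun i _ => (hx i).symm
  clear_value e
  subst he
  rw [sum_nonCrossing_map]
  simp only [complement_push, parts_push, prod_map, hs]

theorem exists_eq_sort_map {w : List (Fin s)} (hw : w ≠ []) :
    ∃ (α : Type) (_ : LinearOrder α) (_ : Fintype α) (_ : Nonempty α) (x : α → Fin s),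
      w = (univ : Finset α).sort.map x := by
  refine ⟨Fin w.length, inferInstance, inferInstance, ⟨⟨0, List.length_pos_iff.2 hw⟩⟩, w.get, ?_⟩
  rw [Fin.sort_univ, List.map_get_finRange]

/-- Associativity of the convolution of multiplicative functions on non-crossing partitions. -/
theorem Finpartition.sum_nonCrossing_assoc {α : Type*} [LinearOrder α] [Fintype α]
    (F G H FG GH : Finset α → R)
    (hFG : ∀ V : Finset α, V.Nonempty → FG V = ∑ P ∈ nonCrossing V,
      (∏ W ∈ P.parts, F W) * ∏ W ∈ P.complement.parts, G W)
    (hGH : ∀ V : Finset α, V.Nonempty → GH V = ∑ P ∈ nonCrossing V,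
      (∏ W ∈ P.parts, G W) * ∏ W ∈ P.complement.parts, H W) :
    ∑ P ∈ nonCrossing (univ : Finset α), (∏ V ∈ P.parts, FG V) * ∏ V ∈ P.complement.parts, H V =
      ∑ P ∈ nonCrossing (univ : Finset α),
        (∏ V ∈ P.parts, F V) * ∏ V ∈ P.complement.parts, GH V := by
  classical
  have h1 : ∀ P ∈ nonCrossing (univ : Finset α),
      (∏ V ∈ P.parts, FG V) * ∏ V ∈ P.complement.parts, H V =
        ∑ Q ∈ (nonCrossing univ).filter (fun Q => Q.Rel ≤ P.Rel),
          (∏ V ∈ Q.parts, F V) * (∏ V ∈ (P.relKreweras Q).parts, G V) *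
            ∏ V ∈ P.complement.parts, H V := fun P hP => by
    rw [prod_congr rfl fun V hV => hFG V (P.nonempty_of_mem_parts hV),
      prod_sum_nonCrossing hP F G, sum_mul]
  have h2 : ∀ Q ∈ nonCrossing (univ : Finset α),
      (∏ V ∈ Q.parts, F V) * ∏ V ∈ Q.complement.parts, GH V =
        ∑ σ ∈ (nonCrossing univ).filter (fun σ => σ.Rel ≤ Q.complement.Rel),
          (∏ V ∈ Q.parts, F V) * (∏ V ∈ σ.parts, G V) *
            ∏ V ∈ (Q.complement.relKreweras σ).parts, H V := fun Q hQ => by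
    rw [prod_congr rfl fun V hV => hGH V (Q.complement.nonempty_of_mem_parts hV),
      prod_sum_nonCrossing Q.complement_mem_nonCrossing G H, mul_sum]
    simp only [mul_assoc]
  rw [sum_congr rfl h1, sum_congr rfl h2]
  exact sum_nonCrossing_relKreweras fun Q σ τ =>
    (∏ V ∈ Q.parts, F V) * (∏ V ∈ σ.parts, G V) * ∏ V ∈ τ.parts, H V

theorem boxConv_assoc_sort {α : Type*} [LinearOrder α] [Fintype α] [Nonempty α]
    (f g h : NCSeries s R) (x : α → Fin s) :
    boxConv (boxConv f g) h ((univ : Finset α).sort.map x) =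
      boxConv f (boxConv g h) ((univ : Finset α).sort.map x) := by
  rw [boxConv_sort _ _ x univ_nonempty, boxConv_sort _ _ x univ_nonempty]
  have hfg := fun (V : Finset α) (hV : V.Nonempty) => boxConv_sort f g x hV
  have hgh := fun (V : Finset α) (hV : V.Nonempty) => boxConv_sort g h x hV
  have key := @sum_nonCrossing_assoc R _ α _ _ (fun V => f (V.sort.map x))
    (fun V => g (V.sort.map x)) (fun V => h (V.sort.map x)) (fun V => boxConv f g (V.sort.map x))
    (fun V => boxConv g h (V.sort.map x)) hfg hgh
  exact key

theorem boxConv_assoc (f g h : NCSeries s R) :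
    boxConv (boxConv f g) h = boxConv f (boxConv g h) := by
  ext w
  by_cases hw : w = []
  · simp [hw, boxConv_nil]
  obtain ⟨α, _, _, _, x, rfl⟩ := exists_eq_sort_map hw
  exact boxConv_assoc_sort f g h x

end BoxConv

/-! ### The group structure -/

namespace Finpartition

variable {α : Type*} [LinearOrder α] [Fintype α]

theorem rel_bot (a b : α) : (⊥ : Finpartition (univ : Finset α)).Rel a b ↔ a = b := by
  simp only [Rel, mem_bot_iff]
  constructor
  · rintro ⟨_, ⟨c, -, rfl⟩, ha, hb⟩
    rw [mem_singleton.1 ha, mem_singleton.1 hb]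
  · rintro rfl
    exact ⟨{a}, ⟨a, mem_univ a, rfl⟩, mem_singleton_self a, mem_singleton_self a⟩

theorem univ_mem_parts_iff [Nonempty α] (P : Finpartition (univ : Finset α)) :
    univ ∈ P.parts ↔ ∀ a b, P.Rel a b := by
  constructor
  · exact fun h a b => ⟨univ, h, mem_univ a, mem_univ b⟩
  · intro h
    obtain ⟨a⟩ := ‹Nonempty α›
    exact P.mem_parts_iff_rel.2 ⟨a, mem_univ a, fun b => by simp [h a b]⟩

theorem parts_eq_of_univ_mem {P : Finpartition (univ : Finset α)} (h : univ ∈ P.parts) :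
    P.parts = {univ} := by
  refine eq_singleton_iff_unique_mem.2 ⟨h, fun V hV => ?_⟩
  obtain ⟨a, ha⟩ := P.nonempty_of_mem_parts hV
  exact P.eq_of_mem_parts hV h ha (mem_univ a)

theorem exists_card_ne_one {P : Finpartition (univ : Finset α)} (hP : P ≠ ⊥) :
    ∃ V ∈ P.parts, V.card ≠ 1 := by
  by_contra! hall
  refine hP (ext_rel fun a b => ?_)
  rw [rel_bot]
  constructor
  · rintro ⟨V, hV, ha, hb⟩
    exact card_le_one.1 (hall V hV).le a ha b hb
  · rintro rfl
    exact P.rel_self.2 (mem_univ a)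

theorem bot_mem_nonCrossing : (⊥ : Finpartition (univ : Finset α)) ∈ nonCrossing univ := by
  rw [mem_nonCrossing]
  intro a b c d hab hbc hcd hac
  rw [rel_bot] at hac
  exact absurd hac (hab.trans hbc).ne

theorem mem_nonCrossing_of_univ_mem {P : Finpartition (univ : Finset α)} (h : univ ∈ P.parts) :
    P ∈ nonCrossing univ :=
  mem_nonCrossing.2 fun a b _ _ _ _ _ _ _ => ⟨univ, h, mem_univ a, mem_univ b⟩

/-- The complement of the discrete partition has one block, and the complement is injective on
non-crossing partitions. -/
theorem univ_mem_complement_parts_iff [Nonempty α] {P : Finpartition (univ : Finset α)}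
    (hP : P ∈ nonCrossing univ) : univ ∈ P.complement.parts ↔ P = ⊥ := by
  have hbot : ∀ a b, (⊥ : Finpartition (univ : Finset α)).complement.Rel a b := by
    intro a b
    rw [rel_complement_univ]
    refine ⟨trivial, fun x y _ h => ?_⟩
    rw [(rel_bot x y).1 h]
  constructor
  · intro h
    rw [univ_mem_parts_iff] at h
    have : P.complement = (⊥ : Finpartition (univ : Finset α)).complement :=
      ext_rel fun a b => by simp [h a b, hbot a b]
    rw [← invComplement_complement hP, this, invComplement_complement bot_mem_nonCrossing]
  · rintro rfl
    exact (univ_mem_parts_iff _).2 hbot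

theorem complement_eq_bot_iff [Nonempty α] {P : Finpartition (univ : Finset α)}
    (hP : P ∈ nonCrossing univ) : P.complement = ⊥ ↔ univ ∈ P.parts := by
  have htop : ∀ Q : Finpartition (univ : Finset α), univ ∈ Q.parts → Q.complement = ⊥ := by
    intro Q hQ
    refine ext_rel fun a b => ?_
    rw [rel_bot, rel_complement_univ]
    rw [univ_mem_parts_iff] at hQ
    constructor
    · rintro ⟨-, h⟩
      have h1 := h a b trivial (hQ a b)
      grind
    · rintro rfl
      exact krewerasRel_self trivial
  constructor
  · intro h
    let T : Finpartition (univ : Finset α) := indiscrete univ_nonempty.ne_empty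
    have hT : univ ∈ T.parts := by simp [T]
    have := invComplement_complement hP
    rw [h, ← htop T hT, invComplement_complement (mem_nonCrossing_of_univ_mem hT)] at this
    exact this ▸ hT
  · exact htop P

end Finpartition

/-! ### Extreme terms of the convolution, the unit and inverses. -/

section BoxConv

open Finpartition

variable {s : ℕ} {R : Type*} [CommRing R]

theorem length_sort_map {m : ℕ} (V : Finset (Fin m)) (x : Fin m → Fin s) :
    (V.sort.map x).length = V.card := by simp

/-- The boxed convolution at `w` only involves words of length at most `|w|`. -/
theorem boxConv_congr {f f' g g' : NCSeries s R} {w : List (Fin s)}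
    (hf : ∀ v, 1 ≤ v.length → v.length ≤ w.length → f v = f' v)
    (hg : ∀ v, 1 ≤ v.length → v.length ≤ w.length → g v = g' v) :
    boxConv f g w = boxConv f' g' w := by
  by_cases hw : w = []
  · simp [hw, boxConv_nil]
  rw [boxConv_of_ne_nil _ _ hw, boxConv_of_ne_nil _ _ hw]
  have key : ∀ (P : Finpartition (univ : Finset (Fin w.length))), ∀ V ∈ P.parts,
      1 ≤ (V.sort.map w.get).length ∧ (V.sort.map w.get).length ≤ w.length := by
    intro P V hV
    rw [length_sort_map]
    exact ⟨card_pos.2 (P.nonempty_of_mem_parts hV), by simpa using card_le_univ V⟩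
  refine sum_congr rfl fun P _ => ?_
  congr 1
  · exact prod_congr rfl fun V hV => hf _ (key P V hV).1 (key P V hV).2
  · exact prod_congr rfl fun V hV => hg _ (key _ V hV).1 (key _ V hV).2

/-- The product of the coefficients of the letters of a word. -/
def letterProd (f : NCSeries s R) (w : List (Fin s)) : R := (w.map fun a => f [a]).prod

theorem prod_parts_bot (f : NCSeries s R) (w : List (Fin s)) :
    ∏ V ∈ (⊥ : Finpartition (univ : Finset (Fin w.length))).parts, f (V.sort.map w.get) =
      letterProd f w := by
  rw [parts_bot, prod_map]
  simp only [Function.Embedding.coeFn_mk, sort_singleton, List.map_cons, List.map_nil]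
  exact Fin.prod_univ_fun_getElem w fun a => f [a]

theorem prod_parts_of_univ_mem (f : NCSeries s R) (w : List (Fin s))
    {P : Finpartition (univ : Finset (Fin w.length))} (hP : univ ∈ P.parts) :
    ∏ V ∈ P.parts, f (V.sort.map w.get) = f w := by
  rw [parts_eq_of_univ_mem hP, prod_singleton, Fin.sort_univ, List.map_get_finRange]

theorem nonempty_fin_length {w : List (Fin s)} (hw : w ≠ []) : Nonempty (Fin w.length) :=
  ⟨⟨0, List.length_pos_iff.2 hw⟩⟩

-- The one-block partition is split off: its complement is discrete, and in every other term `f` is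
-- evaluated only at words shorter than `w`.
open Classical in
theorem boxConv_eq_left_add (f g : NCSeries s R) {w : List (Fin s)} (hw : w ≠ []) :
    boxConv f g w = f w * letterProd g w +
      ∑ P ∈ (nonCrossing (univ : Finset (Fin w.length))).filter (fun P => univ ∉ P.parts),
        (∏ V ∈ P.parts, f (V.sort.map w.get)) *
          ∏ V ∈ P.complement.parts, g (V.sort.map w.get) := by
  have := nonempty_fin_length hw
  rw [boxConv_of_ne_nil _ _ hw, ← sum_filter_add_sum_filter_not _ (fun P => univ ∈ P.parts)]
  congr 1
  let T : Finpartition (univ : Finset (Fin w.length)) := indiscrete univ_nonempty.ne_empty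
  have hT : univ ∈ T.parts := by simp [T]
  have hTn := mem_nonCrossing_of_univ_mem hT
  rw [sum_eq_single_of_mem T (mem_filter.2 ⟨hTn, hT⟩) fun P hP hne => ?_]
  · rw [prod_parts_of_univ_mem f w hT, (complement_eq_bot_iff hTn).2 hT, prod_parts_bot]
  · have hP := parts_eq_of_univ_mem (mem_filter.1 hP).2
    exact absurd (Finpartition.ext (hP.trans (parts_eq_of_univ_mem hT).symm)) hne

-- The discrete partition is split off: it is the only one whose complement has a single block.
open Classical in
theorem boxConv_eq_right_add (f g : NCSeries s R) {w : List (Fin s)} (hw : w ≠ []) :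
    boxConv f g w = letterProd f w * g w +
      ∑ P ∈ (nonCrossing (univ : Finset (Fin w.length))).filter
          (fun P => univ ∉ P.complement.parts),
        (∏ V ∈ P.parts, f (V.sort.map w.get)) *
          ∏ V ∈ P.complement.parts, g (V.sort.map w.get) := by
  have := nonempty_fin_length hw
  rw [boxConv_of_ne_nil _ _ hw,
    ← sum_filter_add_sum_filter_not _ (fun P => univ ∈ P.complement.parts)]
  congr 1
  have hb := (univ_mem_complement_parts_iff (α := Fin w.length) bot_mem_nonCrossing).2 rfl
  rw [sum_eq_single_of_mem ⊥ (mem_filter.2 ⟨bot_mem_nonCrossing, hb⟩) fun P hP hne => ?_]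
  · rw [prod_parts_of_univ_mem g w hb, prod_parts_bot]
  · have hP := mem_filter.1 hP
    exact absurd ((univ_mem_complement_parts_iff hP.1).1 hP.2) hne

theorem boxConv_sub_boxConv {f f' : NCSeries s R} (g : NCSeries s R) {w : List (Fin s)}
    (hw : w ≠ []) (h : ∀ v, v.length < w.length → f v = f' v) :
    boxConv f' g w = boxConv f g w + (f' w - f w) * letterProd g w := by
  classical
  rw [boxConv_eq_left_add _ _ hw, boxConv_eq_left_add _ _ hw, sum_congr rfl fun P hP => ?_]
  · ring
  · congr 1
    refine prod_congr rfl fun V hV => (h _ ?_).symm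
    rw [length_sort_map]
    have hne : V ≠ univ := fun hV' => (mem_filter.1 hP).2 (hV' ▸ hV)
    simpa using card_lt_card (ssubset_univ_iff.2 hne)

/-- The series `z_1 + ⋯ + z_s`. -/
def letterSum (s : ℕ) (R : Type*) [CommRing R] : NCSeries s R :=
  fun w => if w.length = 1 then 1 else 0

/-- Any partition other than the discrete one has a block that is not a singleton, and there the
letter sum has coefficient `0`. -/
theorem letterSum_boxConv (f : NCSeries s R) {w : List (Fin s)} (hw : w ≠ []) :
    boxConv (letterSum s R) f w = f w := by
  classical
  have := nonempty_fin_length hw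
  have h1 : letterProd (letterSum s R) w = 1 := by simp [letterProd, letterSum]
  rw [boxConv_eq_right_add _ _ hw, h1, one_mul, sum_eq_zero fun P hP => ?_, add_zero]
  rw [mem_filter] at hP
  have hPb : P ≠ ⊥ := fun h => hP.2 ((univ_mem_complement_parts_iff hP.1).2 h)
  obtain ⟨V, hV, hc⟩ := exists_card_ne_one hPb
  rw [prod_eq_zero hV, zero_mul]
  rw [letterSum, length_sort_map, if_neg hc]

theorem exists_boxConv_eq_letterSum {f : NCSeries s R} (hf : ∀ i, IsUnit (f [i])) (d : ℕ) :
    ∃ g : NCSeries s R, ∀ w, w ≠ [] → w.length ≤ d → boxConv g f w = letterSum s R w := by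
  have hu : ∀ w : List (Fin s), ∃ u, u * letterProd f w = 1 := fun w => by
    have : IsUnit (letterProd f w) := by
      rw [letterProd]
      induction w with
      | nil => simp
      | cons a w ih => simpa using ⟨hf a, ih⟩
    exact this.exists_left_inv
  choose u hu using hu
  induction d with
  | zero => exact ⟨0, fun w hw hl => absurd (List.length_eq_zero_iff.1 (Nat.le_zero.1 hl)) hw⟩
  | succ d ih =>
    obtain ⟨g, hg⟩ := ih
    -- The error at length `d + 1` is divided by the unit `letterProd f w`. Shorter words keep their
    -- values, so the equations already solved persist.
    refine ⟨fun w => if w.length = d + 1 then g w + (letterSum s R w - boxConv g f w) * u w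
      else g w, fun w hw hl => ?_⟩
    rcases Nat.le_succ_iff.1 hl with hl | hl
    · rw [← hg w hw hl]
      refine boxConv_congr (fun v _ hv => ?_) fun _ _ _ => rfl
      rw [if_neg (by omega)]
    · rw [boxConv_sub_boxConv (f := g) f hw fun v hv => ?_]
      · rw [if_pos hl, add_sub_cancel_left, mul_assoc, hu]
        ring
      · rw [if_neg (by omega)]

theorem truncate_apply {n : ℕ} (f : NCSeries s R) {w : List (Fin s)} (h1 : 1 ≤ w.length)
    (h2 : w.length ≤ n) : truncate n f w = f w := if_pos ⟨h1, h2⟩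

theorem truncate_congr {n : ℕ} {f g : NCSeries s R}
    (h : ∀ w, 1 ≤ w.length → w.length ≤ n → f w = g w) : truncate n f = truncate n g := by
  ext w
  by_cases hw : 1 ≤ w.length ∧ w.length ≤ n
  · rw [truncate_apply _ hw.1 hw.2, truncate_apply _ hw.1 hw.2, h w hw.1 hw.2]
  · rw [truncate, truncate, if_neg hw, if_neg hw]

/-- A coefficient of the convolution depends only on words that are no longer, so inner truncations
do not matter. -/
theorem truncate_boxConv_assoc (n : ℕ) (f g h : NCSeries s R) :
    truncate n (boxConv (truncate n (boxConv f g)) h) =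
      truncate n (boxConv f (truncate n (boxConv g h))) := by
  refine truncate_congr fun w h1 h2 => ?_
  rw [boxConv_congr (f' := boxConv f g) (g' := h) (fun v hv hv' => truncate_apply _ hv (by omega))
    fun _ _ _ => rfl, boxConv_assoc]
  exact boxConv_congr (fun _ _ _ => rfl) fun v hv hv' => (truncate_apply _ hv (by omega)).symm

theorem eq_truncate {n : ℕ} {f g : NCSeries s R} (hf : IsTruncated n f)
    (h : ∀ w, 1 ≤ w.length → w.length ≤ n → g w = f w) : truncate n g = f := by
  rw [truncate_congr h]
  ext w
  by_cases hw : 1 ≤ w.length ∧ w.length ≤ n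
  · exact truncate_apply _ hw.1 hw.2
  · rw [truncate, if_neg hw, hf w hw]

theorem isTruncated_letterSum {n : ℕ} (hn : 1 ≤ n) : IsTruncated n (letterSum s R) :=
  fun w hw => if_neg fun h => hw (by omega)

theorem letterSum_singleton (i : Fin s) : letterSum s R [i] = 1 := rfl

theorem truncate_letterSum_boxConv {n : ℕ} {f : NCSeries s R} (hf : IsTruncated n f) :
    truncate n (boxConv (letterSum s R) f) = f :=
  eq_truncate hf fun _ h1 _ => letterSum_boxConv f (List.length_pos_iff.1 h1)

theorem exists_truncated_leftInverse {n : ℕ} (hn : 1 ≤ n) {f : NCSeries s R}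
    (hf : ∀ i, IsUnit (f [i])) :
    ∃ g : NCSeries s R, IsTruncated n g ∧ (∀ i, g [i] * f [i] = 1) ∧
      truncate n (boxConv g f) = letterSum s R := by
  obtain ⟨g, hg⟩ := exists_boxConv_eq_letterSum hf n
  refine ⟨truncate n g, isTruncated_truncate n g, fun i => ?_,
    eq_truncate (isTruncated_letterSum hn) fun w h1 h2 => ?_⟩
  · rw [truncate_apply _ (by simp) (by simpa using hn), ← boxConv_singleton,
      hg [i] (by simp) (by simpa using hn), letterSum_singleton]
  · rw [← hg w (List.length_pos_iff.1 h1) h2]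
    exact boxConv_congr (fun v hv hv' => truncate_apply _ hv (by omega)) fun _ _ _ => rfl

end BoxConv

theorem isGroupOperation_of_left {G : Type*} [Mul G] (assoc : ∀ a b c : G, a * b * c = a * (b * c))
    (e : G) (he : ∀ a, e * a = a) (hinv : ∀ a, ∃ b, b * a = e) : IsGroupOperation G := by
  choose i hi using hinv
  let _ : One G := ⟨e⟩
  let _ : Inv G := ⟨i⟩
  exact ⟨Group.ofLeftAxioms assoc he hi, fun _ _ => rfl⟩

theorem isGroupOperation_gTrunc {s n : ℕ} (hn : 1 ≤ n) (R : Type u) [CommRing R] :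
    IsGroupOperation (GTrunc s n R) := by
  refine isGroupOperation_of_left (fun a b c => Subtype.ext (truncate_boxConv_assoc n _ _ _))
    ⟨letterSum s R, isTruncated_letterSum hn, fun i => isUnit_one⟩
    (fun a => Subtype.ext (truncate_letterSum_boxConv a.2.1)) fun a => ?_
  obtain ⟨g, hg, hi, hm⟩ := exists_truncated_leftInverse hn a.2.2
  exact ⟨⟨g, hg, fun i => IsUnit.of_mul_eq_one _ (hi i)⟩, Subtype.ext hm⟩

theorem isGroupOperation_gPlusTrunc {s n : ℕ} (hn : 1 ≤ n) (R : Type u) [CommRing R] :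
    IsGroupOperation (GPlusTrunc s n R) := by
  refine isGroupOperation_of_left (fun a b c => Subtype.ext (truncate_boxConv_assoc n _ _ _))
    ⟨letterSum s R, isTruncated_letterSum hn, fun i => rfl⟩
    (fun a => Subtype.ext (truncate_letterSum_boxConv a.2.1)) fun a => ?_
  obtain ⟨g, hg, hi, hm⟩ := exists_truncated_leftInverse hn
    fun i => (a.2.2 i).symm ▸ isUnit_one
  exact ⟨⟨g, hg, fun i => by simpa [a.2.2 i] using hi i⟩, Subtype.ext hm⟩

/-! ### The action on polynomials in the coefficients -/

section Substitution

open Finpartition MvPolynomial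

variable {s : ℕ} {R : Type*} [CommRing R] {S : Type*} [CommRing S]

theorem map_boxConv (φ : R →+* S) (f g : NCSeries s R) (w : List (Fin s)) :
    φ (boxConv f g w) = boxConv (fun v => φ (f v)) (fun v => φ (g v)) w := by
  by_cases hw : w = []
  · simp [hw, boxConv_nil]
  · simp only [boxConv_of_ne_nil _ _ hw, map_sum, map_mul, map_prod]

/-- The words of length between `1` and `n`. -/
abbrev ShortWord (s n : ℕ) := {w : List (Fin s) // 1 ≤ w.length ∧ w.length ≤ n}

instance (s n : ℕ) : Finite (ShortWord s n) :=
  ((List.finite_length_le (Fin s) n).subset fun _ h => h.2 :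
    {w : List (Fin s) | 1 ≤ w.length ∧ w.length ≤ n}.Finite).to_subtype

theorem ShortWord.ne_nil {s n : ℕ} (w : ShortWord s n) : w.1 ≠ [] := List.length_pos_iff.1 w.2.1

/-- The series of degree `n` whose coefficients are independent variables. -/
noncomputable def genericSeries (s n : ℕ) (R : Type*) [CommRing R] :
    NCSeries s (MvPolynomial (ShortWord s n) R) :=
  fun w => if h : 1 ≤ w.length ∧ w.length ≤ n then X ⟨w, h⟩ else 0

theorem genericSeries_apply {n : ℕ} (w : ShortWord s n) : genericSeries s n R w.1 = X w :=
  dif_pos w.2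

variable {n : ℕ}

/-- The substitution of `f ⊠ g` for `g` in polynomials in the coefficients of `g`. -/
noncomputable def boxSubst (n : ℕ) (f : NCSeries s R) :
    MvPolynomial (ShortWord s n) R →ₐ[R] MvPolynomial (ShortWord s n) R :=
  aeval fun w => boxConv (fun v => C (f v)) (genericSeries s n R) w.1

theorem boxSubst_X (f : NCSeries s R) (w : ShortWord s n) :
    boxSubst n f (X w) = boxConv (fun v => C (f v)) (genericSeries s n R) w.1 := aeval_X _ _

/-- On variables this is associativity, `(f ⊠ g) ⊠ Z = f ⊠ (g ⊠ Z)` for the generic series `Z`. The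
order of composition is reversed. -/
theorem boxSubst_boxConv (f g : NCSeries s R) (p : MvPolynomial (ShortWord s n) R) :
    boxSubst n (truncate n (boxConv f g)) p = boxSubst n g (boxSubst n f p) := by
  suffices h : boxSubst n (truncate n (boxConv f g)) = (boxSubst n g).comp (boxSubst n f) by
    rw [h, AlgHom.comp_apply]
  refine algHom_ext fun w => ?_
  rw [AlgHom.comp_apply, boxSubst_X, boxSubst_X]
  have h1 := map_boxConv (boxSubst n g).toRingHom (fun v => C (f v)) (genericSeries s n R) w.1
  refine Eq.trans ?_ h1.symm
  rw [boxConv_congr (f' := fun v => C (boxConv f g v)) (g' := genericSeries s n R) ?_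
    fun _ _ _ => rfl]
  · have h2 : (fun v => C (boxConv f g v) : NCSeries s (MvPolynomial (ShortWord s n) R)) =
        boxConv (fun v => C (f v)) fun v => C (g v) := funext fun v => map_boxConv C f g v
    rw [h2, boxConv_assoc]
    refine boxConv_congr (fun v _ _ => ?_) fun v hv hv' => ?_
    · exact ((boxSubst n g).commutes (f v)).symm
    · have hv'' : 1 ≤ v.length ∧ v.length ≤ n := ⟨hv, hv'.trans w.2.2⟩
      rw [genericSeries_apply ⟨v, hv''⟩]
      exact (boxSubst_X g ⟨v, hv''⟩).symm
  · exact fun v hv hv' => congrArg C (truncate_apply _ hv (hv'.trans w.2.2))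

theorem boxSubst_letterSum (p : MvPolynomial (ShortWord s n) R) :
    boxSubst n (letterSum s R) p = p := by
  suffices h : boxSubst n (letterSum s R) = AlgHom.id R _ by rw [h, AlgHom.id_apply]
  refine algHom_ext fun w => ?_
  have h : (fun v => C (letterSum s R v) : NCSeries s (MvPolynomial (ShortWord s n) R)) =
      letterSum s _ := by
    ext1 v
    by_cases hv : v.length = 1 <;> simp [letterSum, hv]
  rw [boxSubst_X, h, letterSum_boxConv _ w.ne_nil, genericSeries_apply, AlgHom.id_apply]

theorem map_boxSubst (φ : R →+* S) (f : NCSeries s R) (p : MvPolynomial (ShortWord s n) R) :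
    map φ (boxSubst n f p) = boxSubst n (fun w => φ (f w)) (map φ p) := by
  induction p using MvPolynomial.induction_on with
  | C a => simp [boxSubst]
  | add p q hp hq => simp [hp, hq]
  | mul_X p w hp =>
    rw [map_mul, map_mul, hp, map_mul, map_mul, map_X, boxSubst_X, boxSubst_X,
      map_boxConv (MvPolynomial.map φ)]
    congr 1
    refine boxConv_congr (fun v _ _ => map_C _ _) fun v hv hv' => ?_
    have hv'' : 1 ≤ v.length ∧ v.length ≤ n := ⟨hv, hv'.trans w.2.2⟩
    rw [genericSeries_apply ⟨v, hv''⟩, genericSeries_apply ⟨v, hv''⟩, map_X]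

/-- The weight of a variable is the length of its word. -/
abbrev wordWeight (w : ShortWord s n) : ℕ := w.1.length

theorem Finsupp.induction_single_one {σ : Type*} {p : (σ →₀ ℕ) → Prop} (zero : p 0)
    (single : ∀ a, p (Finsupp.single a 1)) (add : ∀ M M', p M → p M' → p (M + M'))
    (M : σ →₀ ℕ) : p M := by
  refine Finsupp.induction_linear M zero add fun a b => ?_
  induction b with
  | zero => simpa using zero
  | succ b ih => simpa [Finsupp.single_add] using add _ _ ih (single a)

theorem monomial_add_one {σ : Type*} (M M' : σ →₀ ℕ) :
    monomial (M + M') (1 : R) = monomial M 1 * monomial M' 1 := by simp [monomial_mul]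

/-- In the term of `π` the variables are indexed by the blocks of the complement of `π`, whose sizes
add up to the length of the word. -/
theorem isWeightedHomogeneous_boxSubst (f : NCSeries s R) (M : ShortWord s n →₀ ℕ) :
    IsWeightedHomogeneous (wordWeight (s := s) (n := n)) (boxSubst n f (monomial M 1))
      (Finsupp.weight wordWeight M) := by
  induction M using Finsupp.induction_single_one with
  | zero => simpa using isWeightedHomogeneous_one R (wordWeight (s := s) (n := n))
  | add M M' h h' =>
    rw [monomial_add_one, map_mul, map_add]
    exact h.mul h'
  | single w =>
    have hX : monomial (Finsupp.single w 1) (1 : R) = X w := rfl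
    rw [hX, boxSubst_X, boxConv_of_ne_nil _ _ w.ne_nil, Finsupp.weight_single, one_smul]
    refine IsWeightedHomogeneous.sum _ _ _ fun P _ => ?_
    rw [← map_prod]
    refine IsWeightedHomogeneous.C_mul ?_ _
    have hcard : wordWeight w = ∑ V ∈ P.complement.parts, V.card := by
      rw [P.complement.sum_card_parts]
      simp
    rw [hcard]
    refine IsWeightedHomogeneous.prod _ _ _ fun V _ => ?_
    rw [genericSeries]
    split_ifs with h
    · have := isWeightedHomogeneous_X R (wordWeight (s := s) (n := n))
        ⟨V.sort.map w.1.get, h⟩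
      rwa [wordWeight, length_sort_map] at this
    · exact isWeightedHomogeneous_zero R _ _

theorem letterProd_C (f : NCSeries s R) (w : List (Fin s)) :
    letterProd (fun v => C (f v) : NCSeries s (MvPolynomial (ShortWord s n) R)) w =
      C (letterProd f w) := by
  rw [letterProd, letterProd, map_list_prod, List.map_map]
  rfl

theorem genericSeries_mem_idealOfVars (w : List (Fin s)) :
    genericSeries s n R w ∈ idealOfVars (ShortWord s n) R := by
  rw [genericSeries]
  split_ifs
  · exact Ideal.subset_span ⟨_, rfl⟩
  · exact zero_mem _

theorem two_le_card_parts {α : Type*} [LinearOrder α] [Fintype α] [Nonempty α]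
    {P : Finpartition (univ : Finset α)} (hP : univ ∉ P.parts) : 2 ≤ P.parts.card := by
  have h0 : P.parts.card ≠ 0 := by
    rw [card_ne_zero]
    exact P.parts_nonempty univ_nonempty.ne_empty
  have h1 : P.parts.card ≠ 1 := fun h => by
    obtain ⟨V, hV⟩ := card_eq_one.1 h
    have := P.biUnion_parts
    rw [hV, singleton_biUnion] at this
    have hVP : V ∈ P.parts := hV.symm ▸ mem_singleton_self V
    rw [id] at this
    subst this
    exact hP hVP
  omega

/-- The split-off term is linear; in every other term the complement has at least two blocks, each
giving a factor in the ideal of the variables. -/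
theorem boxSubst_X_sub_mem (f : NCSeries s R) (w : ShortWord s n) :
    boxSubst n f (X w) - C (letterProd f w.1) * X w ∈ idealOfVars (ShortWord s n) R ^ 2 := by
  classical
  have := nonempty_fin_length w.ne_nil
  rw [boxSubst_X, boxConv_eq_right_add _ _ w.ne_nil, letterProd_C, genericSeries_apply,
    add_sub_cancel_left]
  refine sum_mem fun P hP => Ideal.mul_mem_left _ _ ?_
  refine Ideal.pow_le_pow_right (two_le_card_parts (mem_filter.1 hP).2) ?_
  rw [← prod_const]
  exact Ideal.prod_mem_prod fun V _ => genericSeries_mem_idealOfVars _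

theorem monomial_mem_pow_idealOfVars {σ : Type*} (M : σ →₀ ℕ) (a : R) :
    monomial M a ∈ idealOfVars σ R ^ M.degree := by
  classical
  rw [mem_pow_idealOfVars_iff']
  intro x hx
  rw [coeff_monomial, if_neg]
  rintro rfl
  exact lt_irrefl _ hx

theorem boxSubst_monomial_sub_mem (f : NCSeries s R) (M : ShortWord s n →₀ ℕ) :
    ∃ c : R, ((∀ i, f [i] = 1) → c = 1) ∧
      boxSubst n f (monomial M 1) - C c * monomial M 1 ∈
        idealOfVars (ShortWord s n) R ^ (M.degree + 1) := by
  induction M using Finsupp.induction_single_one with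
  | zero => exact ⟨1, fun _ => rfl, by simp⟩
  | single w =>
    refine ⟨letterProd f w.1, fun h => by simp [letterProd, h], ?_⟩
    rw [Finsupp.degree_single]
    exact boxSubst_X_sub_mem f w
  | add M M' h h' =>
    obtain ⟨c, hc, h⟩ := h
    obtain ⟨c', hc', h'⟩ := h'
    refine ⟨c * c', fun hf => by rw [hc hf, hc' hf, one_mul], ?_⟩
    set I := idealOfVars (ShortWord s n) R
    have hM : C c * monomial M 1 ∈ I ^ M.degree :=
      Ideal.mul_mem_left _ _ (monomial_mem_pow_idealOfVars M 1)
    have hM' : boxSubst n f (monomial M' 1) ∈ I ^ M'.degree := by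
      have h1 := add_mem (Ideal.pow_le_pow_right (Nat.le_succ M'.degree) h')
        (Ideal.mul_mem_left _ (C c') (monomial_mem_pow_idealOfVars (R := R) M' 1))
      rwa [sub_add_cancel] at h1
    have h1 := Ideal.mul_mem_mul h hM'
    have h2 := Ideal.mul_mem_mul hM h'
    rw [← pow_add] at h1 h2
    rw [map_add, monomial_add_one, map_mul, map_mul]
    rw [show M.degree + 1 + M'.degree = M.degree + M'.degree + 1 by ring] at h1
    rw [show M.degree + (M'.degree + 1) = M.degree + M'.degree + 1 by ring] at h2
    -- With `a`, `b` the images of the monomials `m`, `m'`, this is `ab - cc'mm' = (a - cm)b + cm(b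
    -- - c'm')`.
    convert add_mem h1 h2 using 1
    ring

theorem coeff_boxSubst_of_degree_le (f : NCSeries s R) {M M' : ShortWord s n →₀ ℕ}
    (hne : M ≠ M') (h : M'.degree ≤ M.degree) :
    coeff M' (boxSubst n f (monomial M 1)) = 0 := by
  classical
  obtain ⟨c, -, hc⟩ := boxSubst_monomial_sub_mem f M
  have := (mem_pow_idealOfVars_iff' _ _).1 hc M' (by omega)
  simpa [coeff_monomial, hne, sub_eq_zero] using this

theorem coeff_boxSubst_self {f : NCSeries s R} (hf : ∀ i, f [i] = 1) (M : ShortWord s n →₀ ℕ) :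
    coeff M (boxSubst n f (monomial M 1)) = 1 := by
  classical
  obtain ⟨c, hc1, hc⟩ := boxSubst_monomial_sub_mem f M
  have := (mem_pow_idealOfVars_iff' _ _).1 hc M (by omega)
  simpa [coeff_monomial, hc1 hf, sub_eq_zero] using this

/-- The exponent of the product of the variables of the letters of a word. -/
noncomputable def letterExponent (hn : 1 ≤ n) (w : List (Fin s)) : ShortWord s n →₀ ℕ :=
  (w.map fun a => Finsupp.single (⟨[a], le_rfl, hn⟩ : ShortWord s n) 1).sum

theorem letterProd_genericSeries (hn : 1 ≤ n) (w : List (Fin s)) :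
    letterProd (genericSeries s n R) w = monomial (letterExponent hn w) 1 := by
  induction w with
  | nil => simp [letterProd, letterExponent]
  | cons a w ih =>
    have h1 : letterProd (genericSeries s n R) (a :: w) =
        genericSeries s n R [a] * letterProd (genericSeries s n R) w := by simp [letterProd]
    have h2 : letterExponent hn (a :: w) =
        Finsupp.single ⟨[a], le_rfl, hn⟩ 1 + letterExponent hn w := by simp [letterExponent]
    rw [h1, h2, ih, monomial_add_one, genericSeries_apply ⟨[a], le_rfl, hn⟩]
    rfl

theorem letterExponent_apply_of_ne (hn : 1 ≤ n) (w : List (Fin s)) {v : ShortWord s n}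
    (hv : v.1.length ≠ 1) : letterExponent hn w v = 0 := by
  induction w with
  | nil => simp [letterExponent]
  | cons a w ih =>
    have h2 : letterExponent hn (a :: w) =
        Finsupp.single ⟨[a], le_rfl, hn⟩ 1 + letterExponent hn w := by simp [letterExponent]
    rw [h2, Finsupp.add_apply, ih, Finsupp.single_eq_of_ne, add_zero]
    rintro rfl
    exact hv rfl

theorem weight_letterExponent (hn : 1 ≤ n) (w : List (Fin s)) :
    Finsupp.weight wordWeight (letterExponent hn w) = w.length := by
  induction w with
  | nil => simp [letterExponent]
  | cons a w ih =>
    have h2 : letterExponent hn (a :: w) =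
        Finsupp.single ⟨[a], le_rfl, hn⟩ 1 + letterExponent hn w := by simp [letterExponent]
    rw [h2, map_add, ih, Finsupp.weight_single]
    simp [add_comm, wordWeight]

/-- Only the one-block partition has a complement made of singletons. All other terms vanish or
contain the variable of a word longer than one letter, hence miss the monomial of the letters. -/
theorem coeff_letterExponent_boxSubst (hn : 1 ≤ n) (f : NCSeries s R) (w : ShortWord s n) :
    coeff (letterExponent hn w.1) (boxSubst n f (monomial (Finsupp.single w 1) 1)) = f w.1 := by
  classical
  have := nonempty_fin_length w.ne_nil
  have hX : monomial (Finsupp.single w 1) (1 : R) = X w := rfl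
  rw [hX, boxSubst_X, boxConv_eq_left_add _ _ w.ne_nil, letterProd_genericSeries hn, coeff_add,
    coeff_C_mul, coeff_monomial, if_pos rfl, mul_one, coeff_sum, sum_eq_zero, add_zero]
  intro P hP
  rw [mem_filter] at hP
  rw [← map_prod, coeff_C_mul]
  have hPb : P.complement ≠ ⊥ := fun h => hP.2 ((complement_eq_bot_iff hP.1).1 h)
  obtain ⟨V, hV, hc⟩ := exists_card_ne_one hPb
  rw [← mul_prod_erase _ _ hV, genericSeries]
  split_ifs with h
  · rw [coeff_X_mul', if_neg, mul_zero]
    rw [Finsupp.mem_support_iff, not_not]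
    exact letterExponent_apply_of_ne hn _ (by rwa [length_sort_map])
  · simp

end Substitution

/-! ### The matrix representation -/

section Representation

open MvPolynomial

variable {s n : ℕ} {R : Type*} [CommRing R] {S : Type*} [CommRing S]

/-- The exponents of the monomials of weight at most `n`. -/
abbrev LowExponent (s n : ℕ) := {M : ShortWord s n →₀ ℕ // Finsupp.weight wordWeight M ≤ n}

instance (s n : ℕ) : Finite (LowExponent s n) :=
  (Finsupp.finite_of_nat_weight_le wordWeight
    (fun w => Nat.one_le_iff_ne_zero.1 w.2.1) n).to_subtype

noncomputable instance (s n : ℕ) : Fintype (LowExponent s n) := Fintype.ofFinite _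

theorem exists_equiv_monotone {ι : Type*} [Fintype ι] (d : ι → ℕ) :
    ∃ e : Fin (Fintype.card ι) ≃ ι, Monotone fun i => d (e i) := by
  let e := (Fintype.equivFin ι).symm
  exact ⟨(Tuple.sort fun i => d (e i)).trans e, Tuple.monotone_sort fun i => d (e i)⟩

/-- An enumeration of the monomials of weight at most `n` by increasing degree. -/
noncomputable def lowEquiv (s n : ℕ) : Fin (Fintype.card (LowExponent s n)) ≃ LowExponent s n :=
  (exists_equiv_monotone fun M : LowExponent s n => M.1.degree).choose

theorem monotone_degree_lowEquiv (s n : ℕ) : Monotone fun i => (lowEquiv s n i).1.degree :=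
  (exists_equiv_monotone fun M : LowExponent s n => M.1.degree).choose_spec

/-- The dimension of the representation. -/
noncomputable abbrev repDim (s n : ℕ) : ℕ := Fintype.card (LowExponent s n)

/-- The matrix of `boxSubst n f` on the monomials of weight at most `n`. -/
noncomputable def boxMatrix (n : ℕ) (f : NCSeries s R) :
    Matrix (Fin (repDim s n)) (Fin (repDim s n)) R :=
  Matrix.of fun i j => coeff (lowEquiv s n j).1 (boxSubst n f (monomial (lowEquiv s n i).1 1))

theorem boxMatrix_apply (f : NCSeries s R) (i j : Fin (repDim s n)) :
    boxMatrix n f i j = coeff (lowEquiv s n j).1 (boxSubst n f (monomial (lowEquiv s n i).1 1)) :=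
  rfl

/-- By homogeneity no monomial of weight above `n` occurs in the image; this is the invariance that
makes the matrices multiplicative. -/
theorem boxSubst_monomial_eq_sum (f : NCSeries s R) (M : LowExponent s n) :
    boxSubst n f (monomial M.1 1) = ∑ M' : LowExponent s n,
      C (coeff M'.1 (boxSubst n f (monomial M.1 1))) * monomial M'.1 1 := by
  classical
  ext M'
  simp only [coeff_sum, coeff_C_mul, coeff_monomial, mul_ite, mul_one, mul_zero]
  by_cases hM' : Finsupp.weight wordWeight M' ≤ n
  · rw [sum_eq_single ⟨M', hM'⟩]
    · simp
    · intro N _ hN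
      rw [if_neg]
      rintro rfl
      exact hN rfl
    · simp
  · rw [(isWeightedHomogeneous_boxSubst f M.1).coeff_eq_zero M' fun h => hM' (h ▸ M.2),
      sum_eq_zero]
    intro N _
    rw [if_neg]
    rintro rfl
    exact hM' N.2

/-- Images of monomials are stored as rows, which undoes the reversal in `boxSubst_boxConv`. -/
theorem boxMatrix_boxConv (f g : NCSeries s R) :
    boxMatrix n (truncate n (boxConv f g)) = boxMatrix n f * boxMatrix n g := by
  ext i j
  rw [Matrix.mul_apply]
  simp only [boxMatrix_apply]
  rw [boxSubst_boxConv]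
  conv_lhs => rw [boxSubst_monomial_eq_sum f, map_sum, coeff_sum, ← (lowEquiv s n).sum_comp]
  refine sum_congr rfl fun l _ => ?_
  have h : ∀ a : R, boxSubst n g (C a) = C a := fun a => (boxSubst n g).commutes a
  rw [map_mul, h, coeff_C_mul]

theorem boxMatrix_letterSum : boxMatrix n (letterSum s R) = 1 := by
  classical
  ext i j
  rw [boxMatrix_apply, boxSubst_letterSum, coeff_monomial, Matrix.one_apply]
  simp [← Subtype.ext_iff]

theorem boxMatrix_map (φ : R →+* S) (f : NCSeries s R) :
    boxMatrix n (fun w => φ (f w)) = (boxMatrix n f).map φ := by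
  ext i j
  rw [Matrix.map_apply, boxMatrix_apply, boxMatrix_apply, ← coeff_map, map_boxSubst, map_monomial,
    map_one φ]

/-- A left inverse series gives a left inverse matrix, which is two-sided over a commutative ring.
-/
theorem isUnit_boxMatrix (hn : 1 ≤ n) {f : NCSeries s R} (hf : ∀ i, IsUnit (f [i])) :
    IsUnit (boxMatrix n f) := by
  obtain ⟨g, -, -, hg⟩ := exists_truncated_leftInverse hn hf
  have h := boxMatrix_boxConv (n := n) g f
  rw [hg, boxMatrix_letterSum] at h
  exact IsUnit.of_mul_eq_one _ (mul_eq_one_comm.1 h.symm)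

theorem boxMatrix_upper (f : NCSeries s R) {i j : Fin (repDim s n)} (h : j < i) :
    boxMatrix n f i j = 0 :=
  coeff_boxSubst_of_degree_le f
    (fun h' => h.ne' ((lowEquiv s n).injective (Subtype.ext h')))
    (monotone_degree_lowEquiv s n h.le)

theorem boxMatrix_diag {f : NCSeries s R} (hf : ∀ i, f [i] = 1) (i : Fin (repDim s n)) :
    boxMatrix n f i i = 1 :=
  coeff_boxSubst_self hf _

open Classical in
/-- The matrix of a series as an element of the general linear group. -/
noncomputable def boxGL (n : ℕ) (f : NCSeries s R) : GL (Fin (repDim s n)) R :=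
  -- For `1 ≤ n` and unit letter coefficients the default `1` is not reached, by `isUnit_boxMatrix`.
  if h : IsUnit (boxMatrix n f) then h.unit else 1

theorem coe_boxGL (hn : 1 ≤ n) {f : NCSeries s R} (hf : ∀ i, IsUnit (f [i])) :
    (boxGL n f).1 = boxMatrix n f := by
  rw [boxGL, dif_pos (isUnit_boxMatrix hn hf), IsUnit.unit_spec]

/-- The row of the variable of a word. -/
noncomputable def wordIndex (w : ShortWord s n) : Fin (repDim s n) :=
  (lowEquiv s n).symm ⟨Finsupp.single w 1, by
    rw [Finsupp.weight_single, one_smul]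
    exact w.2.2⟩

/-- The column of the product of the variables of the letters of a word. -/
noncomputable def letterIndex (hn : 1 ≤ n) (w : ShortWord s n) : Fin (repDim s n) :=
  (lowEquiv s n).symm ⟨letterExponent hn w.1, by
    rw [weight_letterExponent]
    exact w.2.2⟩

/-- Letter coefficients thus sit on the diagonal, so membership in the Borel or unipotent group
already forces them to be units or `1`. -/
theorem letterIndex_singleton (hn : 1 ≤ n) (i : Fin s) :
    letterIndex hn ⟨[i], le_rfl, hn⟩ = wordIndex ⟨[i], le_rfl, hn⟩ := by
  simp [letterIndex, wordIndex, letterExponent]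

/-- The series whose coefficients are read off from a matrix. -/
noncomputable def matrixSeries (hn : 1 ≤ n) (A : Matrix (Fin (repDim s n)) (Fin (repDim s n)) R) :
    NCSeries s R :=
  fun w => if h : 1 ≤ w.length ∧ w.length ≤ n then A (wordIndex ⟨w, h⟩) (letterIndex hn ⟨w, h⟩)
    else 0

theorem isTruncated_matrixSeries (hn : 1 ≤ n)
    (A : Matrix (Fin (repDim s n)) (Fin (repDim s n)) R) : IsTruncated n (matrixSeries hn A) :=
  fun _ hw => dif_neg hw

theorem matrixSeries_singleton (hn : 1 ≤ n) (A : Matrix (Fin (repDim s n)) (Fin (repDim s n)) R)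
    (i : Fin s) : matrixSeries hn A [i] =
      A (wordIndex ⟨[i], le_rfl, hn⟩) (wordIndex ⟨[i], le_rfl, hn⟩) := by
  have h : matrixSeries hn A [i] =
      A (wordIndex ⟨[i], le_rfl, hn⟩) (letterIndex hn ⟨[i], le_rfl, hn⟩) :=
    dif_pos (show 1 ≤ [i].length ∧ [i].length ≤ n from ⟨le_rfl, hn⟩)
  rw [h, letterIndex_singleton]

theorem matrixSeries_map (hn : 1 ≤ n) (φ : R →+* S)
    (A : Matrix (Fin (repDim s n)) (Fin (repDim s n)) R) :
    matrixSeries hn (A.map φ) = fun w => φ (matrixSeries hn A w) := by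
  ext w
  rw [matrixSeries, matrixSeries]
  split_ifs
  · rfl
  · rw [map_zero]

theorem matrixSeries_boxMatrix (hn : 1 ≤ n) {f : NCSeries s R} (hf : IsTruncated n f) :
    matrixSeries hn (boxMatrix n f) = f := by
  ext w
  rw [matrixSeries]
  split_ifs with h
  · rw [boxMatrix_apply, wordIndex, letterIndex, Equiv.apply_symm_apply, Equiv.apply_symm_apply]
    exact coeff_letterExponent_boxSubst hn f ⟨w, h⟩
  · exact (hf w h).symm

/-- Equations for the matrices of series. -/
noncomputable def boxEquations {k : Type u} [Field k] (hn : 1 ≤ n) :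
    Set (MvPolynomial (Fin (repDim s n) × Fin (repDim s n)) k) :=
  Set.range fun e => X e -
    boxMatrix n (matrixSeries hn (Matrix.of fun i j => X (i, j))) e.1 e.2

/-- The equations are written for the matrix of independent variables over `k`; evaluation
specialises it to `A`, and reading off a series and forming its matrix commute with ring maps. -/
theorem forall_boxEquations_iff {k : Type u} [Field k] [Algebra k R] (hn : 1 ≤ n)
    (A : Matrix (Fin (repDim s n)) (Fin (repDim s n)) R) :
    (∀ p ∈ boxEquations (k := k) hn, aeval (fun e => A e.1 e.2) p = 0) ↔
      boxMatrix n (matrixSeries hn A) = A := by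
  let φ : MvPolynomial (Fin (repDim s n) × Fin (repDim s n)) k →+* R :=
    (aeval fun e => A e.1 e.2 : MvPolynomial (Fin (repDim s n) × Fin (repDim s n)) k →ₐ[k] R)
  have hA : (Matrix.of fun i j => X (i, j) :
      Matrix _ _ (MvPolynomial (Fin (repDim s n) × Fin (repDim s n)) k)).map φ = A := by
    ext i j
    exact aeval_X _ _
  have key : ∀ e : Fin (repDim s n) × Fin (repDim s n),
      aeval (fun e => A e.1 e.2) (X e -
        boxMatrix n (matrixSeries hn (Matrix.of fun i j => X (i, j))) e.1 e.2 :
          MvPolynomial (Fin (repDim s n) × Fin (repDim s n)) k) =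
        A e.1 e.2 - boxMatrix n (matrixSeries hn A) e.1 e.2 := fun e => by
    rw [map_sub, aeval_X]
    congr 1
    conv_rhs => rw [← hA, matrixSeries_map, boxMatrix_map]
    rfl
  simp only [boxEquations, Set.forall_mem_range, key, sub_eq_zero]
  exact ⟨fun h => Matrix.ext fun i j => (h (i, j)).symm, fun h e => by rw [h]⟩

theorem boxGL_mem_borelGroup (hn : 1 ≤ n) {f : NCSeries s R} (hf : ∀ i, IsUnit (f [i])) :
    boxGL n f ∈ borelGroup (repDim s n) R := fun i j h => by
  rw [coe_boxGL hn hf]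
  exact boxMatrix_upper f h

theorem boxGL_truncate_boxConv (hn : 1 ≤ n) {f g : NCSeries s R} (hf : ∀ i, IsUnit (f [i]))
    (hg : ∀ i, IsUnit (g [i])) (hfg : ∀ i, IsUnit (truncate n (boxConv f g) [i])) :
    boxGL n (truncate n (boxConv f g)) = boxGL n f * boxGL n g := by
  refine Units.ext ?_
  rw [Units.val_mul, coe_boxGL hn hf, coe_boxGL hn hg, coe_boxGL hn hfg, boxMatrix_boxConv]

theorem boxGL_map (hn : 1 ≤ n) (φ : R →+* S) {f : NCSeries s R} (hf : ∀ i, IsUnit (f [i])) :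
    boxGL n (fun w => φ (f w)) = Matrix.GeneralLinearGroup.map φ (boxGL n f) := by
  refine Units.ext ?_
  rw [coe_boxGL hn fun i => (hf i).map φ, boxMatrix_map, ← coe_boxGL hn hf]
  rfl

theorem eq_of_boxGL_eq (hn : 1 ≤ n) {f g : NCSeries s R} (hf : ∀ i, IsUnit (f [i]))
    (hg : ∀ i, IsUnit (g [i])) (hf' : IsTruncated n f) (hg' : IsTruncated n g)
    (h : boxGL n f = boxGL n g) : f = g := by
  rw [← matrixSeries_boxMatrix hn hf', ← matrixSeries_boxMatrix hn hg', ← coe_boxGL hn hf,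
    ← coe_boxGL hn hg, h]

theorem isUnit_diag_of_mem_borelGroup {N : ℕ} {A : GL (Fin N) R} (hA : A ∈ borelGroup N R)
    (i : Fin N) : IsUnit (A.1 i i) := by
  have h := borelGroup_mul_diag hA (inv_mem hA) i
  rw [mul_inv_cancel, Units.val_one, Matrix.one_apply_eq] at h
  exact IsUnit.of_mul_eq_one _ h.symm

theorem isFaithfulClosedRep_borel (k : Type u) [Field k] (hn : 1 ≤ n) :
    IsFaithfulClosedRep k (GTrunc s n) GTrunc.map (borelGroup (repDim s n))
      fun _ _ _ f => boxGL n f.1 where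
  map_mul _ _ _ f g := boxGL_truncate_boxConv hn f.2.2 g.2.2 (f * g).2.2
  natural _ _ _ _ _ _ φ f := boxGL_map hn φ.toRingHom f.2.2
  injective _ _ _ f g h := Subtype.ext (eq_of_boxGL_eq hn f.2.2 g.2.2 f.2.1 g.2.1 h)
  closed := by
    refine ⟨boxEquations hn, fun R _ _ => Set.ext fun A => ?_⟩
    rw [Set.mem_ofPred_eq, forall_boxEquations_iff]
    constructor
    · rintro ⟨f, rfl⟩
      refine ⟨boxGL_mem_borelGroup hn f.2.2, ?_⟩
      rw [coe_boxGL hn f.2.2, matrixSeries_boxMatrix hn f.2.1]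
    · rintro ⟨hA, h⟩
      have hu : ∀ i, IsUnit (matrixSeries hn A.1 [i]) := fun i => by
        rw [matrixSeries_singleton]
        exact isUnit_diag_of_mem_borelGroup hA _
      refine ⟨⟨matrixSeries hn A.1, isTruncated_matrixSeries hn _, hu⟩, Units.ext ?_⟩
      exact (coe_boxGL hn hu).trans h

theorem isFaithfulClosedRep_unipotent (k : Type u) [Field k] (hn : 1 ≤ n) :
    IsFaithfulClosedRep k (GPlusTrunc s n) GPlusTrunc.map (unipotentGroup (repDim s n))
      fun _ _ _ f => boxGL n f.1 := by
  have hu : ∀ {R : Type u} [CommRing R] {f : NCSeries s R}, (∀ i, f [i] = 1) →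
      ∀ i, IsUnit (f [i]) := fun h i => (h i).symm ▸ isUnit_one
  refine ⟨fun R _ _ f g => ?_, fun R S _ _ _ _ φ f => ?_, fun R _ _ f g h => ?_, ?_⟩
  · exact boxGL_truncate_boxConv hn (hu f.2.2) (hu g.2.2) (hu (f * g).2.2)
  · exact boxGL_map hn φ.toRingHom (hu f.2.2)
  · exact Subtype.ext (eq_of_boxGL_eq hn (hu f.2.2) (hu g.2.2) f.2.1 g.2.1 h)
  · refine ⟨boxEquations hn, fun R _ _ => Set.ext fun A => ?_⟩
    rw [Set.mem_ofPred_eq, forall_boxEquations_iff]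
    constructor
    · rintro ⟨f, rfl⟩
      refine ⟨⟨boxGL_mem_borelGroup hn (hu f.2.2), fun i => ?_⟩, ?_⟩
      · rw [coe_boxGL hn (hu f.2.2)]
        exact boxMatrix_diag f.2.2 i
      · rw [coe_boxGL hn (hu f.2.2), matrixSeries_boxMatrix hn f.2.1]
    · rintro ⟨hA, h⟩
      have h1 : ∀ i, matrixSeries hn A.1 [i] = 1 := fun i => by
        rw [matrixSeries_singleton]
        exact hA.2 _
      refine ⟨⟨matrixSeries hn A.1, isTruncated_matrixSeries hn _, h1⟩, Units.ext ?_⟩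
      exact (coe_boxGL hn (hu h1)).trans h

end Representation

/-! ### The torus -/

section Torus

/-- Diagonal matrices with unit entries. -/
def diagGL (N : ℕ) (R : Type*) [CommRing R] : (Fin N → Rˣ) →* GL (Fin N) R :=
  (Units.map (Matrix.diagonalRingHom (Fin N) R).toMonoidHom).comp
    (MulEquiv.piUnits (M := fun _ : Fin N => R)).symm.toMonoidHom

theorem coe_diagGL {N : ℕ} {R : Type*} [CommRing R] (t : Fin N → Rˣ) :
    (diagGL N R t).1 = Matrix.diagonal fun i => (t i : R) := rfl

theorem torusGroup_eq_range (N : ℕ) (R : Type*) [CommRing R] :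
    torusGroup N R = (diagGL N R).range := rfl

variable {s : ℕ} {R : Type u} [CommRing R]

/-- The coefficients of the letters. -/
noncomputable def letterUnits (f : GTrunc s 1 R) (i : Fin s) : Rˣ := (f.2.2 i).unit

theorem coe_letterUnits (f : GTrunc s 1 R) (i : Fin s) : (letterUnits f i : R) = f.1 [i] := rfl

theorem coe_gTrunc_mul {n : ℕ} (f g : GTrunc s n R) :
    (f * g).1 = truncate n (boxConv f.1 g.1) := rfl

theorem letterUnits_mul (f g : GTrunc s 1 R) :
    letterUnits (f * g) = letterUnits f * letterUnits g := by
  ext i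
  rw [Pi.mul_apply, Units.val_mul, coe_letterUnits, coe_letterUnits, coe_letterUnits,
    ← boxConv_singleton, coe_gTrunc_mul, truncate_apply _ (by simp) (by simp)]

theorem letterUnits_bijective : Function.Bijective (letterUnits (s := s) (R := R)) := by
  constructor
  · intro f g h
    refine Subtype.ext (funext fun w => ?_)
    by_cases hw : w.length = 1
    · obtain ⟨i, rfl⟩ := List.length_eq_one_iff.1 hw
      rw [← coe_letterUnits, ← coe_letterUnits, h]
    · rw [f.2.1 w (by omega), g.2.1 w (by omega)]
  · intro t
    -- On a one-letter word the product is just the value of `t` at its letter.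
    let f : NCSeries s R := fun w => if w.length = 1 then (w.map fun i => (t i : R)).prod else 0
    have hf : ∀ i, f [i] = t i := fun i => by simp [f]
    refine ⟨⟨f, fun w hw => if_neg (by omega), fun i => hf i ▸ (t i).isUnit⟩, funext fun i => ?_⟩
    exact Units.ext (hf i)

theorem diagGL_injective (N : ℕ) (R : Type*) [CommRing R] : Function.Injective (diagGL N R) := by
  intro t t' h
  have h1 := congrArg Units.val h
  rw [coe_diagGL, coe_diagGL] at h1
  exact funext fun i => Units.ext (congrFun (Matrix.diagonal_injective h1) i)

theorem range_diagGL_letterUnits :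
    Set.range (fun f : GTrunc s 1 R => diagGL s R (letterUnits f)) = torusGroup s R := by
  rw [torusGroup_eq_range, MonoidHom.coe_range]
  exact letterUnits_bijective.2.range_comp (diagGL s R)

theorem isFaithfulClosedRep_torus (s : ℕ) (k : Type u) [Field k] :
    IsFaithfulClosedRep k (GTrunc s 1) GTrunc.map (torusGroup s)
      fun R _ _ f => diagGL s R (letterUnits f) where
  map_mul R _ _ f g := by rw [letterUnits_mul, map_mul]
  natural R S _ _ _ _ φ f := by
    refine Units.ext (Matrix.ext fun i j => ?_)
    change Matrix.diagonal (fun i => φ (f.1 [i])) i j =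
      φ (Matrix.diagonal (fun i => f.1 [i]) i j)
    by_cases h : i = j
    · subst h
      simp
    · simp [h]
  injective R _ _ := (diagGL_injective s R).comp letterUnits_bijective.1
  -- The image is the whole torus, so no equations are needed.
  closed := ⟨∅, fun R _ _ => by simpa using range_diagGL_letterUnits⟩

end Torus

theorem mainTheorem4 (s n : ℕ) (hs : 1 ≤ s) (hn : 1 ≤ n) :
    (∃ N : ℕ, ∀ (k : Type u) [Field k],
      (∀ (R : Type u) [CommRing R] [Algebra k R],
        IsGroupOperation (GTrunc s n R) ∧ IsGroupOperation (GPlusTrunc s n R)) ∧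
      (∃ ρ : (R : Type u) → [CommRing R] → [Algebra k R] → GTrunc s n R → GL (Fin N) R,
        IsFaithfulClosedRep k (GTrunc s n) GTrunc.map (borelGroup N) ρ) ∧
      (∃ ρ : (R : Type u) → [CommRing R] → [Algebra k R] → GPlusTrunc s n R → GL (Fin N) R,
        IsFaithfulClosedRep k (GPlusTrunc s n) GPlusTrunc.map (unipotentGroup N) ρ)) ∧
    (∀ (k : Type u) [Field k],
      ∃ ρ : (R : Type u) → [CommRing R] → [Algebra k R] → GTrunc s 1 R → GL (Fin s) R,
        IsFaithfulClosedRep k (GTrunc s 1) GTrunc.map (torusGroup s) ρ ∧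
        ∀ (R : Type u) [CommRing R] [Algebra k R], Set.range (ρ R) = torusGroup s R) :=
  ⟨⟨repDim s n, fun k _ =>
    ⟨fun R _ _ => ⟨isGroupOperation_gTrunc hn R, isGroupOperation_gPlusTrunc hn R⟩,
      ⟨_, isFaithfulClosedRep_borel k hn⟩, ⟨_, isFaithfulClosedRep_unipotent k hn⟩⟩⟩,
    fun k _ => ⟨_, isFaithfulClosedRep_torus s k, fun _ _ _ => range_diagGL_letterUnits⟩⟩
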